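/- Let $T,N\ge 1$, let $\mathsf N(y;\mu,S)$ denote the Gaussian density on $\mathbb R^D$ with mean $\mu$ and positive definite covariance $S$, and write $[N]_0=\{0,\dots,N\}$. Quantities with time index $t\le 0$ are to be ignored (so $M_1(x_1|x_0)=M_1(x_1)$, etc.). For $t=1,\dots,T$ let $Q_t(x_{t-1},x_t)=M_t(x_t|x_{t-1})\,G_t(x_{t-1},x_t)$ with $M_t(x_t|x_{t-1})=\mathsf N(x_t;m_t(x_{t-1}),C_t(x_{t-1}))$, where $m_t$ and $C_t$ are measurable and $C_t$ is symmetric positive definite, and where $G_t>0$ is measurable and differentiable in $x_t$. Assume $\int\prod_{t=1}^T Q_t(x_{t-1},x_t)\,dx_{1:T}<\infty$ and let $\pi_T$ be the probability distribution on $(\mathbb R^D)^T$ with density proportional to $\prod_{t=1}^T Q_t(x_{t-1},x_t)$. Fix $\kappa\in\{0,1\}$ and step sizes $\delta_1,\dots,\delta_T>0$, and set $$A_t(x)=\bigl(C_t(x)+\tfrac{\delta_t}{2}I\bigr)^{-1}C_t(x),\quad m'_t(x,u)=m_t(x)+A_t(x)\bigl(u-m_t(x)\bigr),\quad C'_t(x)=(I-A_t(x))C_t(x),$$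 $$M'_t(y|x;u)=\mathsf N\bigl(y;m'_t(x,u),C'_t(x)\bigr),\qquad G'_t(x,y;u)=Q_t(x,y)\,\frac{\mathsf N\bigl(u;\,y+\kappa\tfrac{\delta_t}{2}\nabla_y\log G_t(x,y),\,\tfrac{\delta_t}{2}I\bigr)}{M'_t(y|x;u)},\qquad Q'_t=M'_tG'_t .$$ One iteration of Particle-aGRAD, given $x_{1:T}\in(\mathbb R^D)^T$, is as follows. 1. For $t=1,\dots,T$: draw $k_t$ uniformly from $[N]_0$ and set $x_t^{k_t}=x_t$; if $t>1$, set $a_{t-1}^{k_t}=k_{t-1}$ and, for $n\neq k_t$, independently draw $a_{t-1}^n=i$ with probability $W_{t-1}^i$; draw $u_t\sim\mathsf N\bigl(x_t+\kappa\tfrac{\delta_t}{2}\nabla_{x_t}\log G_t(x_{t-1},x_t),\tfrac{\delta_t}{2}I\bigr)$ and then, independently for $n\ne k_t$, $x_t^n\sim M'_t(\cdot\,|x_{t-1}^{a_{t-1}^n};u_t)$; for $n\in[N]_0$ set $w_t^n=G'_t(x_{t-1}^{a_{t-1}^n},x_t^n;u_t)$ and $W_t^n=w_t^n/\sum_{m=0}^N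 w_t^m$. 2. Draw $i\in[N]_0\setminus\{k_T\}$ with probability $W_T^i/(1-W_T^{k_T})$; set $l_T=i$ with probability $1\wedge\frac{1-W_T^{k_T}}{1-W_T^i}$ and $l_T=k_T$ otherwise. 3. For $t=T-1,\dots,1$ draw $l_t=i\in[N]_0$ with probability proportional to $W_t^i\,Q'_{t+1}(x_t^i,x_{t+1}^{l_{t+1}};u_{t+1})$. 4. Return $\tilde x_{1:T}=(x_1^{l_1},\dots,x_T^{l_T})$. Then sampling $\tilde x_{1:T}$ given $x_{1:T}$ in this way induces a Markov kernel on $(\mathbb R^D)^T$ which leaves $\pi_T$ invariant. Moreover, for all $t$, $x$, $u$, the proposal $M'_t(\cdot\,|x;u)$ is the fully-adapted auxiliary-particle-filter proposal for the state-space model with transition densities $M_t$ and pseudo-observations $u_t\,|\,x_t\sim\mathsf N(x_t,\tfrac{\delta_t}{2}I)$, i.e. it has the density $$M'_t(y|x;u)=\frac{M_t(y|x)\,\mathsf N(u;y,\tfrac{\delta_t}{2}I)}{\int M_t(z|x)\,\mathsf N(u;z,\tfrac{\delta_t}{2}I)\,dz},$$ and $C'_t(x)=\tfrac{\delta_t}{2}A_t(x)$.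 -/

import Mathlib

open MeasureTheory ProbabilityTheory
open scoped Matrix

noncomputable section

namespace ParticleAGrad

/-- The state space `ℝ^D` with its Euclidean norm. -/
abbrev State (D : ℕ) : Type := EuclideanSpace ℝ (Fin D)

/-- A trajectory `x_{1:T}`; time `t` of the text is index `t - 1` of `Fin T`. -/
abbrev Path (D T : ℕ) : Type := Fin T → State D

/-- The Gaussian density `N(y; μ, S)` on `ℝ^D`, evaluated at `y`
(for a positive definite covariance matrix `S`). -/
def gaussDensity {D : ℕ} (μ : State D) (S : Matrix (Fin D) (Fin D) ℝ) (y : State D) : ℝ :=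
  (Real.sqrt ((2 * Real.pi) ^ D * S.det))⁻¹ *
    Real.exp (-(1 / 2) * ((y - μ).ofLp ⬝ᵥ (S⁻¹ *ᵥ (y - μ).ofLp)))

/-- A Feynman--Kac model `Q_t(x_{t-1:t}) = M_t(x_t | x_{t-1}) G_t(x_{t-1:t})`, `t = 1, …, T`, with
conditionally Gaussian mutation densities `M_t(x_t | x_{t-1}) = N(x_t; m_t(x_{t-1}), C_t(x_{t-1}))`
and positive potentials that are differentiable in the current state. The first argument of `m t`,
`C t`, `G t` is the previous state; at the first time step it is always the dummy value `0`
(see `pred`), so there these functions amount to `m_1`, `C_1` and `G_1(x_1)`. -/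
structure Model (D T : ℕ) where
  m : Fin T → State D → State D
  C : Fin T → State D → Matrix (Fin D) (Fin D) ℝ
  G : Fin T → State D → State D → ℝ
  measurable_m : ∀ t, Measurable (m t)
  measurable_C : ∀ t i j, Measurable fun x => C t x i j
  posDef_C : ∀ t x, (C t x).PosDef
  measurable_G : ∀ t, Measurable fun p : State D × State D => G t p.1 p.2
  pos_G : ∀ t x y, 0 < G t x y
  differentiable_G : ∀ t x, Differentiable ℝ (G t x)

/-- The predecessor `x_{t-1}` of time `t` along a trajectory (dummy value `0` at the first time). -/
def pred {D T : ℕ} (x : Path D T) (t : Fin T) : State D :=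
  if 0 < t.val then x ⟨t.val - 1, by omega⟩ else 0

namespace Model

variable {D T : ℕ} (F : Model D T)

/-- The mutation density `M_t(y | x)`. -/
def M (t : Fin T) (x y : State D) : ℝ := gaussDensity (F.m t x) (F.C t x) y

/-- `Q_t(x, y) = M_t(y | x) G_t(x, y)`. -/
def Q (t : Fin T) (x y : State D) : ℝ := F.M t x y * F.G t x y

/-- The unnormalised density `∏_t Q_t(x_{t-1:t})` of the joint smoothing distribution. -/
def pathDensity (x : Path D T) : ℝ := ∏ t : Fin T, F.Q t (pred x t) (x t)

/-- The joint smoothing distribution `π_T`, proportional to `∏_t Q_t(x_{t-1:t})`. -/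
def smoothing : Measure (Path D T) :=
  (∫⁻ x, ENNReal.ofReal (F.pathDensity x))⁻¹ •
    (volume : Measure (Path D T)).withDensity fun x => ENNReal.ofReal (F.pathDensity x)

/-! The proposal, the potential and the weights, given the switch `κ` and the step sizes `δ`. -/

/-- `A_t(x) = (C_t(x) + (δ_t/2) I)⁻¹ C_t(x)`. -/
def A (δ : Fin T → ℝ) (t : Fin T) (x : State D) : Matrix (Fin D) (Fin D) ℝ :=
  (F.C t x + (δ t / 2) • (1 : Matrix (Fin D) (Fin D) ℝ))⁻¹ * F.C t x

/-- `m'_t(x, u) = m_t(x) + A_t(x) (u - m_t(x))`. -/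
def propMean (δ : Fin T → ℝ) (t : Fin T) (x u : State D) : State D :=
  F.m t x + WithLp.toLp 2 (F.A δ t x *ᵥ (u - F.m t x).ofLp)

/-- `C'_t(x) = (I - A_t(x)) C_t(x)`. -/
def propCov (δ : Fin T → ℝ) (t : Fin T) (x : State D) : Matrix (Fin D) (Fin D) ℝ :=
  (1 - F.A δ t x) * F.C t x

/-- The proposal kernel `M'_t(· | x; u)`, as a probability distribution. -/
def propLaw (δ : Fin T → ℝ) (t : Fin T) (x u : State D) : Measure (State D) :=
  multivariateGaussian (F.propMean δ t x u) (F.propCov δ t x)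

/-- The proposal density `M'_t(y | x; u)`. -/
def propDensity (δ : Fin T → ℝ) (t : Fin T) (x u y : State D) : ℝ :=
  gaussDensity (F.propMean δ t x u) (F.propCov δ t x) y

/-- The covariance matrix `(δ_t/2) I` of the auxiliary variable `u_t`. -/
def auxCov (δ : Fin T → ℝ) (t : Fin T) : Matrix (Fin D) (Fin D) ℝ :=
  (δ t / 2) • (1 : Matrix (Fin D) (Fin D) ℝ)

/-- The mean `y + κ (δ_t/2) ∇_y log G_t(x, y)` of the auxiliary variable `u_t`. -/
def auxMean (κ : ℝ) (δ : Fin T → ℝ) (t : Fin T) (x y : State D) : State D :=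
  y + (κ * (δ t / 2)) • gradient (fun z => Real.log (F.G t x z)) y

/-- `G'_t(x, y; u) = Q_t(x, y) N(u; y + κ (δ_t/2) ∇_y log G_t(x, y), (δ_t/2) I) / M'_t(y | x; u)`. -/
def potential (κ : ℝ) (δ : Fin T → ℝ) (t : Fin T) (x y u : State D) : ℝ :=
  F.Q t x y * gaussDensity (F.auxMean κ δ t x y) (auxCov δ t) u / F.propDensity δ t x u y

/-- `Q'_t(x, y; u) = M'_t(y | x; u) G'_t(x, y; u)`. -/
def auxQ (κ : ℝ) (δ : Fin T → ℝ) (t : Fin T) (x y u : State D) : ℝ :=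
  F.propDensity δ t x u y * F.potential κ δ t x y u

end Model

/-- What the algorithm keeps of one time step `t`: the auxiliary variable `u_t`, the particles
`(x_t^n)_n`, the normalised weights `(W_t^n)_n` and the index `k_t` of the reference particle. -/
abbrev Slot (D N : ℕ) : Type :=
  State D × (Fin (N + 1) → State D) × (Fin (N + 1) → ℝ) × Fin (N + 1)

namespace Slot

variable {D N : ℕ}

/-- `u_t`. -/
def aux (s : Slot D N) : State D := s.1

/-- `x_t^n`. -/
def particle (s : Slot D N) (n : Fin (N + 1)) : State D := s.2.1 n

/-- `W_t^n`. -/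
def weight (s : Slot D N) (n : Fin (N + 1)) : ℝ := s.2.2.1 n

/-- `k_t`. -/
def ref (s : Slot D N) : Fin (N + 1) := s.2.2.2

/-- Placeholder for the non-existent time step before the first one: all particles are the dummy
predecessor `0`. -/
def init (D N : ℕ) : Slot D N := (0, fun _ => 0, fun _ => 0, 0)

/-- The last recorded time step. -/
def last : {t : ℕ} → (Fin t → Slot D N) → Slot D N
  | 0, _ => init D N
  | t + 1, H => H (Fin.last t)

end Slot

section Algorithm

variable {D T N : ℕ} (F : Model D T) (κ : ℝ) (δ : Fin T → ℝ)

/-- Probability of the ancestor indices `a = (a_{t-1}^n)_n` given the previous step and `k_t = k`: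
`a^k = k_{t-1}`, and the others are independent, equal to `i` with probability `W_{t-1}^i`.
At the first time step there is nothing to draw, and `a` is a dummy. -/
def ancestorProb (t : Fin T) (s : Slot D N) (k : Fin (N + 1))
    (a : Fin (N + 1) → Fin (N + 1)) : ℝ :=
  if 0 < t.val then
    ∏ n, if n = k then (if a n = Slot.ref s then 1 else 0) else Slot.weight s (a n)
  else if a = fun _ => 0 then 1 else 0

/-- The normalised weights `W_t^n` proportional to `G'_t(x_{t-1}^{a^n}, x_t^n; u_t)`. -/
def normWeights (t : Fin T) (s : Slot D N) (a : Fin (N + 1) → Fin (N + 1))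
    (u : State D) (y : Fin (N + 1) → State D) (n : Fin (N + 1)) : ℝ :=
  F.potential κ δ t (Slot.particle s (a n)) (y n) u /
    ∑ j, F.potential κ δ t (Slot.particle s (a j)) (y j) u

/-- Joint law of the particles `(x_t^n)_n`: the one with index `k` is the reference state `x_t`, and
the others are drawn independently from `M'_t(· | x_{t-1}^{a^n}; u)`. -/
def particleLaw (x : Path D T) (t : Fin T) (s : Slot D N) (k : Fin (N + 1))
    (a : Fin (N + 1) → Fin (N + 1)) (u : State D) : Measure (Fin (N + 1) → State D) :=
  Measure.pi fun n =>
    if n = k then Measure.dirac (x t) else F.propLaw δ t (Slot.particle s (a n)) u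

/-- Law of the auxiliary variable,
`u_t ∼ N(x_t + κ (δ_t/2) ∇_{x_t} log G_t(x_{t-1:t}), (δ_t/2) I)`, along the reference path. -/
def auxLaw (x : Path D T) (t : Fin T) : Measure (State D) :=
  multivariateGaussian (F.auxMean κ δ t (pred x t) (x t)) (Model.auxCov δ t)

/-- Law of the record of time step `t` given the record `s` of the previous one: draw `k_t`
uniformly, then the ancestor indices, then `u_t`, then the particles, and compute the weights. -/
def stepLaw (x : Path D T) (t : Fin T) (s : Slot D N) : Measure (Slot D N) :=
  ∑ k : Fin (N + 1), ((N : ENNReal) + 1)⁻¹ •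
    ∑ a : Fin (N + 1) → Fin (N + 1), ENNReal.ofReal (ancestorProb t s k a) •
      (auxLaw F κ δ x t).bind fun u =>
        (particleLaw F δ x t s k a u).map fun y => (u, y, normWeights F κ δ t s a u y, k)

/-- Law of the records of the first `t` time steps. -/
def forwardLaw (N : ℕ) (x : Path D T) : (t : ℕ) → t ≤ T → Measure (Fin t → Slot D N)
  | 0, _ => Measure.dirac fun i => i.elim0
  | t + 1, h =>
      (forwardLaw N x t (Nat.le_of_succ_le h)).bind fun H =>
        (stepLaw F κ δ x ⟨t, h⟩ (Slot.last H)).map fun s =>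
          Fin.snoc (α := fun _ => Slot D N) H s

/-- Forced move: draw `i ≠ k` with probability `W^i / (1 - W^k)`, accept it with probability
`1 ∧ (1 - W^k) / (1 - W^i)`, and otherwise keep `k`. This is the probability of the outcome `l`. -/
def forcedMoveProb (W : Fin (N + 1) → ℝ) (k l : Fin (N + 1)) : ℝ :=
  ∑ i ∈ Finset.univ.erase k, W i / (1 - W k) *
    ((if l = i then min 1 ((1 - W k) / (1 - W i)) else 0) +
      (if l = k then 1 - min 1 ((1 - W k) / (1 - W i)) else 0))

/-- Backward sampling: probability that `l_t = i` given `l_{t+1} = j`, proportional to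
`W_t^i Q'_{t+1}(x_t^i, x_{t+1}^j; u_{t+1})`. Here `s` and `s'` are the records of the times `t` and
`t + 1`, and `t'` is the index of time `t + 1`. -/
def backwardProb (t' : Fin T) (s s' : Slot D N) (j i : Fin (N + 1)) : ℝ :=
  Slot.weight s i * F.auxQ κ δ t' (Slot.particle s i) (Slot.particle s' j) (Slot.aux s') /
    ∑ n, Slot.weight s n * F.auxQ κ δ t' (Slot.particle s n) (Slot.particle s' j) (Slot.aux s')

/-- Probability of the indices `l_{1:T}` given all the records: `l_T` comes from the forced move,
and then `l_{T-1}, …, l_1` from backward sampling. -/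
def selectionProb (H : Fin T → Slot D N) (l : Fin T → Fin (N + 1)) : ℝ :=
  ∏ t : Fin T,
    if h : t.val + 1 < T then
      backwardProb F κ δ ⟨t.val + 1, h⟩ (H t) (H ⟨t.val + 1, h⟩) (l ⟨t.val + 1, h⟩) (l t)
    else forcedMoveProb (Slot.weight (H t)) (Slot.ref (H t)) (l t)

/-- One iteration of Particle-aGRAD with `N + 1` particles: the law of the new trajectory
`(x_1^{l_1}, …, x_T^{l_T})` given the reference trajectory `x`. -/
def iterationLaw (N : ℕ) (x : Path D T) : Measure (Path D T) :=
  (forwardLaw F κ δ N x T le_rfl).bind fun H =>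
    ∑ l : Fin T → Fin (N + 1), ENNReal.ofReal (selectionProb F κ δ H l) •
      Measure.dirac fun t => Slot.particle (H t) (l t)

end Algorithm

end ParticleAGrad

end

/-! The proof is the extended-space argument for conditional particle filters. Let the reference
path have the unnormalised density ∏ Q_t and run the forward pass along it. By `auxQ_eq`, Q_t times
the density of u_t equals Q'_t = M'_t G'_t. Hence moving the reference state with Q_t and then
drawing u_t has the same effect as taking u_t from Lebesgue measure, drawing the reference particle
from M'_t like all the others, and weighting by its potential G'_t. That potential is W_t^{k_t}
times the sum of all potentials. The factor W_{t-1}^{k_{t-1}} left over from the previous step is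
the one missing from the ancestor probabilities, since the ancestor of the reference particle was
prescribed and not drawn. By induction the records, with their reference indices forgotten, form a
particle system that treats all particles alike, and the last reference index is a draw from W_T
(`sum_lintegral_stepIntegral`, `lintegral_forwardLaw`).

Conversely, in this particle system an index drawn from W_T and continued by backward sampling
selects a path with density ∏ Q_t. The normalising sum in the backward probabilities is the mixture
density obtained by averaging over the ancestor of the selected particle, so it cancels, and u_t
then integrates out (`systemStep_backward`, `systemIntegral_backwardIntegral`).

The forced move joins the two halves: it is reversible with respect to W_T, so it turns k_T drawn
from W_T into l_T drawn from W_T (`forcedMoveProb_balance`, `lintegral_pathDensity_iterationLaw`).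
This part needs only that M'_t is a positive probability density and that the mean of u_t depends
measurably on the states. Working with integrals valued in [0,∞] avoids any finiteness question for
the intermediate measures.

The description of the proposal is Gaussian conjugacy: completing the square gives a posterior with
precision C_t⁻¹ + (2/δ_t) I (`posterior_covariance`, `gaussDensity_mul_gaussDensity`). -/

noncomputable section

namespace ParticleAGrad

/-! ### Product measures: densities, and replacement of one coordinate -/

section ProductIntegrals

/-- The Lebesgue integral of a product of functions of the separate coordinates. -/
theorem lintegral_fin_prod {n : ℕ} {E : Type*} [MeasurableSpace E] (μ : Fin n → Measure E)
    [∀ i, SigmaFinite (μ i)] (f : Fin n → E → ENNReal) (hf : ∀ i, Measurable (f i)) :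
    ∫⁻ x, ∏ i, f i (x i) ∂Measure.pi μ = ∏ i, ∫⁻ y, f i y ∂μ i := by
  induction n with
  | zero => simp
  | succ n ih =>
    rw [← (measurePreserving_piFinSuccAbove μ 0).symm.lintegral_comp_emb
      (MeasurableEquiv.measurableEmbedding _)]
    have h : Measurable fun x : Fin n → E => ∏ i, f i.succ (x i) :=
      Finset.measurable_prod _ fun i _ => (hf i.succ).comp (measurable_pi_apply i)
    rw [Fin.prod_univ_succ, ← ih (fun i => μ i.succ) _ fun i => hf i.succ,
      ← lintegral_prod_mul (hf 0).aemeasurable h.aemeasurable]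
    refine lintegral_congr fun x => ?_
    rw [Fin.prod_univ_succ]
    rfl

/-- A finite product of measures with densities. -/
theorem pi_withDensity {n : ℕ} {E : Type*} [MeasurableSpace E] (μ : Measure E)
    [SigmaFinite μ] (f : Fin n → E → ENNReal) (hf : ∀ i, Measurable (f i))
    [∀ i, SigmaFinite (μ.withDensity (f i))] :
    Measure.pi (fun i => μ.withDensity (f i)) =
      (Measure.pi fun _ : Fin n => μ).withDensity fun x => ∏ i, f i (x i) := by
  refine Measure.pi_eq fun s hs => ?_
  rw [withDensity_apply _ (MeasurableSet.univ_pi hs), ← lintegral_indicator (MeasurableSet.univ_pi hs)]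
  have h : ∀ x : Fin n → E, (Set.univ.pi s).indicator (fun x => ∏ i, f i (x i)) x =
      ∏ i, (s i).indicator (f i) (x i) := by
    intro x
    by_cases hx : x ∈ Set.univ.pi s
    · rw [Set.indicator_of_mem hx]
      exact Finset.prod_congr rfl fun i _ => (Set.indicator_of_mem (hx i trivial) _).symm
    · rw [Set.indicator_of_notMem hx]
      obtain ⟨i, hi⟩ : ∃ i, x i ∉ s i := by simpa [Set.mem_pi] using hx
      exact (Finset.prod_eq_zero (Finset.mem_univ i) (Set.indicator_of_notMem hi _)).symm
  simp_rw [h]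
  rw [lintegral_fin_prod _ _ fun i => (hf i).indicator (hs i)]
  exact Finset.prod_congr rfl fun i _ => by
    rw [lintegral_indicator (hs i), withDensity_apply _ (hs i)]

variable {n : ℕ} {E : Type*} [MeasurableSpace E]

/-- Replacing one coordinate of a product of probability measures by an independent copy. -/
theorem map_update_prod_pi (ν : Fin n → Measure E) [∀ i, IsProbabilityMeasure (ν i)] (k : Fin n) :
    ((Measure.pi ν).prod (ν k)).map (fun p => Function.update p.1 k p.2) = Measure.pi ν := by
  refine (Measure.pi_eq fun s hs => ?_).symm
  rw [Measure.map_apply measurable_update' (MeasurableSet.univ_pi hs)]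
  have h : (fun p : (Fin n → E) × E => Function.update p.1 k p.2) ⁻¹' Set.univ.pi s =
      (Set.univ.pi (Function.update s k Set.univ)) ×ˢ s k := by
    ext p
    simp only [Set.mem_preimage, Set.mem_pi, Set.mem_univ, true_imp_iff, Set.mem_prod]
    constructor
    · intro h
      refine ⟨fun i => ?_, by simpa using h k⟩
      rcases eq_or_ne i k with rfl | hi
      · simp
      · simpa [hi] using h i
    · rintro ⟨h, hk⟩ i
      rcases eq_or_ne i k with rfl | hi
      · simpa using hk
      · simpa [hi] using h i
  rw [h, Measure.prod_prod, Measure.pi_pi, ← Finset.prod_erase_mul _ _ (Finset.mem_univ k),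
    ← Finset.prod_erase_mul (f := fun i => ν i (s i)) _ (Finset.mem_univ k)]
  simp only [Function.update_self, measure_univ, mul_one]
  congr 1
  exact Finset.prod_congr rfl fun i hi => by rw [Function.update_of_ne (Finset.ne_of_mem_erase hi)]

/-- A product measure with one factor a point mass. -/
theorem pi_update_dirac (ν : Fin n → Measure E) [∀ i, IsProbabilityMeasure (ν i)]
    (k : Fin n) (y : E) :
    Measure.pi (fun i => if i = k then Measure.dirac y else ν i) =
      (Measure.pi ν).map fun z => Function.update z k y := by
  have : ∀ i, IsProbabilityMeasure (if i = k then Measure.dirac y else ν i) := by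
    intro i; split_ifs <;> infer_instance
  refine Measure.pi_eq fun s hs => ?_
  rw [Measure.map_apply (by fun_prop) (MeasurableSet.univ_pi hs)]
  by_cases hy : y ∈ s k
  · have h : (fun z : Fin n → E => Function.update z k y) ⁻¹' Set.univ.pi s =
        Set.univ.pi (Function.update s k Set.univ) := by
      ext z
      simp only [Set.mem_preimage, Set.mem_pi, Set.mem_univ, true_imp_iff]
      refine forall_congr' fun i => ?_
      rcases eq_or_ne i k with rfl | hi
      · simpa using hy
      · simp [hi]
    rw [h, Measure.pi_pi]
    refine Finset.prod_congr rfl fun i _ => ?_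
    rcases eq_or_ne i k with rfl | hi
    · simp [Measure.dirac_apply' _ (hs i), hy]
    · simp [hi]
  · have h : (fun z : Fin n → E => Function.update z k y) ⁻¹' Set.univ.pi s = ∅ := by
      ext z
      simp only [Set.mem_preimage, Set.mem_pi, Set.mem_univ, true_imp_iff, Set.mem_empty_iff_false,
        iff_false, not_forall]
      exact ⟨k, by simpa using hy⟩
    rw [h, measure_empty, Finset.prod_eq_zero (Finset.mem_univ k)]
    simp [Measure.dirac_apply' _ (hs k), hy]

/-- The image of a measure with a density of the form `f ∘ g` under `g`. -/
theorem map_withDensity_comp {α β : Type*} [MeasurableSpace α] [MeasurableSpace β]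
    (μ : Measure α) {g : α → β} (hg : Measurable g) {f : β → ENNReal} (hf : Measurable f) :
    (μ.withDensity fun x => f (g x)).map g = (μ.map g).withDensity f := by
  ext s hs
  rw [Measure.map_apply hg hs, withDensity_apply _ (hg hs), withDensity_apply _ hs,
    setLIntegral_map hs hf hg]

end ProductIntegrals

/-! ### The multivariate Gaussian measure and its density -/

section GaussianDensity

variable {D : ℕ}

theorem continuous_gaussDensity (μ : State D) (S : Matrix (Fin D) (Fin D) ℝ) :
    Continuous (gaussDensity μ S) := by
  unfold gaussDensity
  have : Continuous fun y : State D => (y - μ).ofLp := by fun_prop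
  fun_prop

/-- The standard Gaussian is the image of a product of one-dimensional Gaussians under the
volume-preserving identification of ℝ^D with Euclidean space, so its density is the product of the
one-dimensional densities. -/
theorem stdGaussian_eq_withDensity :
    stdGaussian (State D) = volume.withDensity fun y => ENNReal.ofReal (gaussDensity 0 1 y) := by
  rw [← map_pi_eq_stdGaussian, gaussianReal_of_var_ne_zero _ one_ne_zero]
  have : IsProbabilityMeasure (volume.withDensity (gaussianPDF 0 1)) := by
    rw [← gaussianReal_of_var_ne_zero _ one_ne_zero]; infer_instance
  rw [pi_withDensity _ _ fun _ => measurable_gaussianPDF 0 1]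
  have h := map_withDensity_comp (Measure.pi fun _ : Fin D => (volume : Measure ℝ))
    (PiLp.volume_preserving_toLp (Fin D)).measurable
    (f := fun y : State D => ENNReal.ofReal (gaussDensity 0 1 y))
    (continuous_gaussDensity 0 1).measurable.ennreal_ofReal
  rw [← volume_pi, (PiLp.volume_preserving_toLp (Fin D)).map_eq] at h
  rw [← h]
  congr 2
  ext x
  simp only [gaussianPDF, gaussianPDFReal]
  rw [← ENNReal.ofReal_prod_of_nonneg fun i _ => by positivity]
  congr 1
  simp only [gaussDensity, Finset.prod_mul_distrib, ← Real.exp_sum]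
  congr 1
  · have h : ∀ a : ℝ, 0 ≤ a → Real.sqrt (a ^ D) = Real.sqrt a ^ D := fun a ha =>
      (Real.sqrt_eq_iff_mul_self_eq (by positivity) (by positivity)).2 (by
        rw [← mul_pow, Real.mul_self_sqrt ha])
    simp only [NNReal.coe_one, mul_one, Finset.prod_const, Finset.card_univ, Fintype.card_fin,
      Matrix.det_one, h (2 * Real.pi) Real.two_pi_pos.le, inv_pow]
  · simp only [dotProduct, inv_one, Matrix.one_mulVec, Finset.mul_sum, sub_zero]
    exact congrArg Real.exp (Finset.sum_congr rfl fun i _ => by rw [NNReal.coe_one]; ring)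

/-- The Jacobian identity behind the change of variables x ↦ μ + R x with R a symmetric square root
of S: the quadratic form of S⁻¹ at R x reduces to |x|², and √(det S) = |det R|. -/
theorem gaussDensity_sqrt_transport (μ : State D) {S R : Matrix (Fin D) (Fin D) ℝ}
    (hR : R.IsHermitian) (hRS : R * R = S) (hdet : R.det ≠ 0) (x : State D) :
    gaussDensity 0 1 x = |R.det| * gaussDensity μ S (μ + Matrix.toEuclideanCLM (𝕜 := ℝ) R x) := by
  have hu : IsUnit R.det := hdet.isUnit
  have hT : Rᵀ = R := by simpa [Matrix.conjTranspose_eq_transpose_of_trivial] using hR.eq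
  have hq : (Matrix.toEuclideanCLM (𝕜 := ℝ) R x).ofLp ⬝ᵥ
      (S⁻¹ *ᵥ (Matrix.toEuclideanCLM (𝕜 := ℝ) R x).ofLp) = x.ofLp ⬝ᵥ x.ofLp := by
    rw [Matrix.ofLp_toEuclideanCLM, Matrix.mulVec_mulVec, ← hRS, Matrix.mul_inv_rev,
      Matrix.mul_assoc, Matrix.nonsing_inv_mul _ hu, mul_one]
    nth_rewrite 1 [← hT]
    rw [Matrix.mulVec_transpose, ← Matrix.dotProduct_mulVec, Matrix.mulVec_mulVec,
      Matrix.mul_nonsing_inv _ hu, Matrix.one_mulVec]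
  have hs : Real.sqrt ((2 * Real.pi) ^ D * S.det) = Real.sqrt ((2 * Real.pi) ^ D) * |R.det| := by
    rw [Real.sqrt_mul (by positivity), ← hRS, Matrix.det_mul, Real.sqrt_mul_self_eq_abs]
  have ha : |R.det| ≠ 0 := abs_ne_zero.mpr hdet
  simp only [gaussDensity, add_sub_cancel_left, hq, hs, sub_zero, inv_one, Matrix.one_mulVec,
    Matrix.det_one, mul_one]
  field_simp

-- The measure is by definition the image of the standard Gaussian under x ↦ μ + √S x. This affine
-- map scales Lebesgue measure by |det √S|⁻¹, which cancels the Jacobian of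
-- `gaussDensity_sqrt_transport`.
open scoped MatrixOrder in
theorem multivariateGaussian_eq_withDensity (μ : State D) {S : Matrix (Fin D) (Fin D) ℝ}
    (hS : S.PosDef) :
    multivariateGaussian μ S = volume.withDensity fun y => ENNReal.ofReal (gaussDensity μ S y) := by
  set R := CFC.sqrt S with hRdef
  have hRS : R * R = S := CFC.sqrt_mul_sqrt_self S hS.posSemidef.nonneg
  have hR : R.IsHermitian := (CFC.sqrt_nonneg S).isSelfAdjoint
  have hdet : R.det ≠ 0 := by
    intro h
    have := hS.det_pos
    rw [← hRS, Matrix.det_mul, h] at this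
    simp at this
  have ha : 0 < |R.det| := abs_pos.mpr hdet
  set L : State D →L[ℝ] State D := Matrix.toEuclideanCLM (𝕜 := ℝ) R
  have hL : LinearMap.det (L : State D →ₗ[ℝ] State D) = R.det := by
    exact LinearMap.det_toLpLin 2 R
  have hmap : (volume : Measure (State D)).map (fun x => μ + L x) =
      ENNReal.ofReal |R.det|⁻¹ • volume := by
    have h := Measure.map_linearMap_addHaar_eq_smul_addHaar (volume : Measure (State D))
      (f := (L : State D →ₗ[ℝ] State D)) (by rwa [hL])
    rw [hL, abs_inv] at h
    have h2 : (fun x => μ + L x) = (fun x => μ + x) ∘ (L : State D →ₗ[ℝ] State D) := rfl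
    rw [h2, ← Measure.map_map (measurable_const_add μ)
      (show Measurable (L : State D →ₗ[ℝ] State D) from L.continuous.measurable), h, Measure.map_smul,
      map_add_left_eq_self]
  rw [multivariateGaussian, stdGaussian_eq_withDensity]
  have hd : (fun x : State D => ENNReal.ofReal (gaussDensity 0 1 x)) =
      fun x => ENNReal.ofReal |R.det| * ENNReal.ofReal (gaussDensity μ S (μ + L x)) := by
    ext x
    rw [gaussDensity_sqrt_transport μ hR hRS hdet, ENNReal.ofReal_mul ha.le]
  have hm : Measurable fun y : State D => ENNReal.ofReal (gaussDensity μ S y) :=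
    (continuous_gaussDensity μ S).measurable.ennreal_ofReal
  rw [hd]
  rw [map_withDensity_comp volume (g := fun x => μ + L x) (by fun_prop)
    (f := fun y => ENNReal.ofReal |R.det| * ENNReal.ofReal (gaussDensity μ S y))
    (hm.const_mul _), hmap, withDensity_smul_measure]
  rw [show (fun y => ENNReal.ofReal |R.det| * ENNReal.ofReal (gaussDensity μ S y)) =
    ENNReal.ofReal |R.det| • fun y => ENNReal.ofReal (gaussDensity μ S y) from rfl,
    withDensity_smul _ hm, smul_smul, ← ENNReal.ofReal_mul (by positivity),
    inv_mul_cancel₀ ha.ne', ENNReal.ofReal_one, one_smul]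

end GaussianDensity

/-! ### Gaussian prior and Gaussian observation: the posterior -/

section GaussianConjugacy

variable {D : ℕ}

theorem gaussDensity_pos (μ : State D) {S : Matrix (Fin D) (Fin D) ℝ} (hS : S.PosDef)
    (y : State D) : 0 < gaussDensity μ S y := by
  have := hS.det_pos
  unfold gaussDensity
  positivity

theorem lintegral_gaussDensity (μ : State D) {S : Matrix (Fin D) (Fin D) ℝ} (hS : S.PosDef) :
    ∫⁻ y, ENNReal.ofReal (gaussDensity μ S y) = 1 := by
  have h : multivariateGaussian μ S Set.univ = 1 := measure_univ
  rwa [multivariateGaussian_eq_withDensity μ hS, withDensity_apply _ MeasurableSet.univ,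
    Measure.restrict_univ] at h

/-- The inverse of the posterior covariance `(I - (C + dI)⁻¹ C) C` is `C⁻¹ + d⁻¹ I`. -/
theorem posterior_covariance {C : Matrix (Fin D) (Fin D) ℝ} (hC : C.PosDef) {d : ℝ} (hd : 0 < d) :
    (1 - (C + d • (1 : Matrix (Fin D) (Fin D) ℝ))⁻¹ * C) * C =
        d • ((C + d • (1 : Matrix (Fin D) (Fin D) ℝ))⁻¹ * C) ∧
      (d • ((C + d • (1 : Matrix (Fin D) (Fin D) ℝ))⁻¹ * C)) * (C⁻¹ + d⁻¹ • 1) = 1 := by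
  set K := C + d • (1 : Matrix (Fin D) (Fin D) ℝ) with hK
  have hKp : K.PosDef := hC.add_posSemidef (Matrix.PosSemidef.one.smul hd.le)
  have hKu : IsUnit K.det := hKp.det_pos.ne'.isUnit
  have hCu : IsUnit C.det := hC.det_pos.ne'.isUnit
  -- Since C = K - d I, the factor I - A is d K⁻¹, so C' = d A.
  have h1 : 1 - K⁻¹ * C = d • K⁻¹ := by
    have : C = K - d • 1 := by rw [hK]; abel
    nth_rewrite 1 [this]
    rw [mul_sub, Matrix.nonsing_inv_mul _ hKu]
    simp
  refine ⟨by rw [h1, Matrix.smul_mul], ?_⟩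
  rw [mul_add, Matrix.smul_mul, Matrix.mul_assoc, Matrix.mul_nonsing_inv _ hCu, Matrix.mul_smul,
    Matrix.smul_mul, smul_smul, inv_mul_cancel₀ hd.ne', one_smul, mul_one, mul_one,
    ← Matrix.nonsing_inv_mul K hKu, hK, mul_add]
  simp [add_comm]

/-- In the form (I - A) C not even symmetry is visible; both properties come from writing the matrix
as the inverse of the precision C⁻¹ + d⁻¹ I. -/
theorem posterior_covariance_posDef {C : Matrix (Fin D) (Fin D) ℝ} (hC : C.PosDef) {d : ℝ}
    (hd : 0 < d) :
    ((1 - (C + d • (1 : Matrix (Fin D) (Fin D) ℝ))⁻¹ * C) * C).PosDef := by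
  obtain ⟨h1, h2⟩ := posterior_covariance hC hd
  rw [h1, ← Matrix.inv_eq_left_inv h2]
  exact (hC.inv.add_posSemidef (Matrix.PosSemidef.one.smul (inv_nonneg.mpr hd.le))).inv

/-- Completing the square in the product of a Gaussian prior and a Gaussian likelihood. -/
theorem gaussDensity_mul_gaussDensity (m u : State D) {C : Matrix (Fin D) (Fin D) ℝ}
    (hC : C.PosDef) {d : ℝ} (hd : 0 < d) :
    ∃ c : ℝ, 0 < c ∧ ∀ y, gaussDensity m C y *
        gaussDensity y (d • (1 : Matrix (Fin D) (Fin D) ℝ)) u =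
      c * gaussDensity (m + WithLp.toLp 2 (((C + d • (1 : Matrix (Fin D) (Fin D) ℝ))⁻¹ * C) *ᵥ
        (u - m).ofLp)) ((1 - (C + d • (1 : Matrix (Fin D) (Fin D) ℝ))⁻¹ * C) * C) y := by
  obtain ⟨h1, h2⟩ := posterior_covariance hC hd
  have hdet := (posterior_covariance_posDef hC hd).det_pos
  rw [h1] at hdet ⊢
  set A := (C + d • (1 : Matrix (Fin D) (Fin D) ℝ))⁻¹ * C
  set P := C⁻¹ + d⁻¹ • (1 : Matrix (Fin D) (Fin D) ℝ) with hP
  have hinv : (d • A)⁻¹ = P := Matrix.inv_eq_right_inv h2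
  have hPA : P * A = d⁻¹ • 1 := by
    have h3 : P * (d • A) = 1 := mul_eq_one_comm.mp h2
    rw [← h3, Matrix.mul_smul, smul_smul, inv_mul_cancel₀ hd.ne', one_smul]
  have hPT : Pᵀ = P := by
    have : P.IsHermitian :=
      (hC.inv.add_posSemidef (Matrix.PosSemidef.one.smul (inv_nonneg.mpr hd.le))).isHermitian
    simpa [Matrix.conjTranspose_eq_transpose_of_trivial] using this.eq
  have hdi : (d • (1 : Matrix (Fin D) (Fin D) ℝ))⁻¹ = d⁻¹ • 1 :=
    Matrix.inv_eq_right_inv (by rw [Matrix.smul_mul, one_mul, smul_smul, mul_inv_cancel₀ hd.ne', one_smul])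
  have hddet : 0 < (d • (1 : Matrix (Fin D) (Fin D) ℝ)).det := (Matrix.PosDef.one.smul hd).det_pos
  have hCdet := hC.det_pos
  set w := (u - m).ofLp with hw
  -- The square is completed in v = y - m, with w = u - m. The centre is A w because P A = d⁻¹ I,
  -- and the remainder does not depend on v.
  have hquad : ∀ v : Fin D → ℝ, v ⬝ᵥ (C⁻¹ *ᵥ v) + (w - v) ⬝ᵥ ((d⁻¹ • 1 : Matrix _ _ ℝ) *ᵥ (w - v)) =
      (v - A *ᵥ w) ⬝ᵥ (P *ᵥ (v - A *ᵥ w)) + d⁻¹ * (w ⬝ᵥ w - (A *ᵥ w) ⬝ᵥ w) := by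
    intro v
    have e1 : P *ᵥ (A *ᵥ w) = d⁻¹ • w := by
      rw [Matrix.mulVec_mulVec, hPA, Matrix.smul_mulVec, Matrix.one_mulVec]
    have e2 : (A *ᵥ w) ⬝ᵥ (P *ᵥ v) = d⁻¹ * (w ⬝ᵥ v) := by
      rw [Matrix.dotProduct_mulVec, ← Matrix.mulVec_transpose, hPT, e1, smul_dotProduct, smul_eq_mul]
    have e3 : v ⬝ᵥ (P *ᵥ v) = v ⬝ᵥ (C⁻¹ *ᵥ v) + d⁻¹ * (v ⬝ᵥ v) := by
      rw [hP, Matrix.add_mulVec, dotProduct_add, Matrix.smul_mulVec, Matrix.one_mulVec,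
        dotProduct_smul, smul_eq_mul]
    simp only [Matrix.mulVec_sub, sub_dotProduct, dotProduct_sub, Matrix.smul_mulVec,
      Matrix.one_mulVec, dotProduct_smul, smul_eq_mul, e1, e2, e3]
    rw [dotProduct_comm v w]
    ring
  set a := (Real.sqrt ((2 * Real.pi) ^ D * C.det))⁻¹ with ha
  set b := (Real.sqrt ((2 * Real.pi) ^ D * (d • (1 : Matrix (Fin D) (Fin D) ℝ)).det))⁻¹ with hb
  set e := (Real.sqrt ((2 * Real.pi) ^ D * (d • A).det))⁻¹ with he
  have ha0 : 0 < a := by positivity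
  have hb0 : 0 < b := by positivity
  have he0 : 0 < e := by positivity
  -- The constant is the product of the normalising factors of prior and likelihood over that of the
  -- posterior, times the exponential of the remainder. Only its independence of y matters, as it
  -- later cancels.
  refine ⟨a * b / e * Real.exp (-(1 / 2) * (d⁻¹ * (w ⬝ᵥ w - (A *ᵥ w) ⬝ᵥ w))), by positivity,
    fun y => ?_⟩
  have hq := hquad (y - m).ofLp
  have v1 : w - (y - m).ofLp = (u - y).ofLp := by
    rw [hw]; simp
  have v2 : (y - m).ofLp - A *ᵥ w = (y - (m + WithLp.toLp 2 (A *ᵥ w))).ofLp := by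
    simp [sub_sub]
  rw [v1, v2] at hq
  unfold gaussDensity
  rw [hinv, hdi, ← ha, ← hb, ← he]
  have hexp := congrArg (fun t => Real.exp (-(1 / 2) * t)) hq
  simp only [mul_add, Real.exp_add] at hexp
  calc _ = a * b * (Real.exp (-(1 / 2) * ((y - m).ofLp ⬝ᵥ C⁻¹ *ᵥ (y - m).ofLp)) *
        Real.exp (-(1 / 2) * ((u - y).ofLp ⬝ᵥ (d⁻¹ • 1 : Matrix _ _ ℝ) *ᵥ (u - y).ofLp))) := by ring
    _ = _ := by rw [hexp]; field_simp

end GaussianConjugacy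

/-! ### Measurability of matrix operations, Gaussian densities and gradients -/

section Measurability

variable {D : ℕ} {α : Type*} [MeasurableSpace α]

theorem measurable_det {n : ℕ} {S : α → Matrix (Fin n) (Fin n) ℝ}
    (hS : ∀ i j, Measurable fun a => S a i j) : Measurable fun a => (S a).det := by
  simp only [Matrix.det_apply']
  exact Finset.measurable_sum _ fun σ _ =>
    (Finset.measurable_prod _ fun i _ => hS _ _).const_mul _

/-- Cramer's rule expresses the entries through determinants; at singular matrices the formula still
holds with the convention 0⁻¹ = 0. -/
theorem measurable_matrix_inv {n : ℕ} {S : α → Matrix (Fin n) (Fin n) ℝ}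
    (hS : ∀ i j, Measurable fun a => S a i j) (i j : Fin n) : Measurable fun a => (S a)⁻¹ i j := by
  simp only [Matrix.inv_def, Ring.inverse_eq_inv', Matrix.smul_apply, smul_eq_mul,
    Matrix.adjugate_apply]
  refine (measurable_det hS).inv.mul (measurable_det fun k l => ?_)
  simp only [Matrix.updateRow_apply]
  split_ifs
  · exact measurable_const
  · exact hS k l

theorem measurable_matrix_mul {n : ℕ} {S R : α → Matrix (Fin n) (Fin n) ℝ}
    (hS : ∀ i j, Measurable fun a => S a i j) (hR : ∀ i j, Measurable fun a => R a i j)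
    (i j : Fin n) : Measurable fun a => (S a * R a) i j := by
  simp only [Matrix.mul_apply]
  exact Finset.measurable_sum _ fun k _ => (hS _ _).mul (hR _ _)

theorem measurable_mulVec {n : ℕ} {S : α → Matrix (Fin n) (Fin n) ℝ} {v : α → Fin n → ℝ}
    (hS : ∀ i j, Measurable fun a => S a i j) (hv : Measurable v) :
    Measurable fun a => S a *ᵥ v a := by
  refine measurable_pi_iff.2 fun i => ?_
  simp only [Matrix.mulVec, dotProduct]
  exact Finset.measurable_sum _ fun k _ => (hS _ _).mul ((measurable_pi_apply k).comp hv)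

theorem measurable_gaussDensity {μ y : α → State D} {S : α → Matrix (Fin D) (Fin D) ℝ}
    (hμ : Measurable μ) (hS : ∀ i j, Measurable fun a => S a i j) (hy : Measurable y) :
    Measurable fun a => gaussDensity (μ a) (S a) (y a) := by
  have hv : Measurable fun a => (y a - μ a).ofLp :=
    (WithLp.measurable_ofLp 2 _).comp (hy.sub hμ)
  have hw := measurable_mulVec (measurable_matrix_inv hS) hv
  unfold gaussDensity
  refine ((measurable_det hS).const_mul _).sqrt.inv.mul (Measurable.exp (Measurable.const_mul ?_ _))
  simp only [dotProduct]
  exact Finset.measurable_sum _ fun k _ =>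
    ((measurable_pi_apply k).comp hv).mul ((measurable_pi_apply k).comp hw)

/-- The gradient in the second variable of a jointly measurable function. -/
theorem measurable_gradient_right {f : State D → State D → ℝ}
    (hf : Measurable fun p : State D × State D => f p.1 p.2) (hd : ∀ x, Differentiable ℝ (f x)) :
    Measurable fun p : State D × State D => gradient (f p.1) p.2 := by
  have hi : ∀ i, Measurable fun p : State D × State D => gradient (f p.1) p.2 i := by
    intro i
    have h1 : ∀ p : State D × State D, gradient (f p.1) p.2 i =
        fderiv ℝ (f p.1) p.2 (EuclideanSpace.single i 1) := by
      intro p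
      rw [gradient, ← InnerProductSpace.toDual_symm_apply, EuclideanSpace.inner_single_right]
      simp
    simp only [h1]
    -- Each partial derivative is a pointwise limit of measurable difference quotients with
    -- increment 1/n; the degenerate term n = 0 does not affect the limit.
    refine measurable_of_tendsto_metrizable (f := fun (n : ℕ) (p : State D × State D) =>
      (n : ℝ) • (f p.1 (p.2 + (n : ℝ)⁻¹ • EuclideanSpace.single i 1) - f p.1 p.2)) (fun n => ?_) ?_
    · have : Measurable fun p : State D × State D =>
          f p.1 (p.2 + (n : ℝ)⁻¹ • EuclideanSpace.single i 1) :=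
        hf.comp (measurable_fst.prodMk (measurable_snd.add_const _))
      exact (this.sub hf).const_mul (n : ℝ)
    · refine tendsto_pi_nhds.2 fun p => ?_
      exact ((hd p.1 p.2).hasFDerivAt.lim_real _).comp tendsto_natCast_atTop_atTop
  exact (WithLp.measurable_toLp 2 _).comp (measurable_pi_iff.2 hi)

end Measurability

/-! ### The model: positivity, factorisation of Q', posterior form of the proposal -/

namespace Model

variable {D T : ℕ} (F : Model D T) (κ : ℝ) (δ : Fin T → ℝ)

theorem auxCov_posDef (hδ : ∀ t, 0 < δ t) (t : Fin T) : (auxCov (D := D) δ t).PosDef :=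
  Matrix.PosDef.one.smul (half_pos (hδ t))

theorem propCov_posDef (hδ : ∀ t, 0 < δ t) (t : Fin T) (x : State D) : (F.propCov δ t x).PosDef :=
  posterior_covariance_posDef (F.posDef_C t x) (half_pos (hδ t))

theorem propCov_eq (hδ : ∀ t, 0 < δ t) (t : Fin T) (x : State D) :
    F.propCov δ t x = (δ t / 2) • F.A δ t x :=
  (posterior_covariance (F.posDef_C t x) (half_pos (hδ t))).1

theorem propLaw_eq_withDensity (hδ : ∀ t, 0 < δ t) (t : Fin T) (x u : State D) :
    F.propLaw δ t x u = volume.withDensity fun y => ENNReal.ofReal (F.propDensity δ t x u y) :=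
  multivariateGaussian_eq_withDensity _ (F.propCov_posDef δ hδ t x)

theorem propDensity_pos (hδ : ∀ t, 0 < δ t) (t : Fin T) (x u y : State D) :
    0 < F.propDensity δ t x u y :=
  gaussDensity_pos _ (F.propCov_posDef δ hδ t x) y

theorem lintegral_propDensity (hδ : ∀ t, 0 < δ t) (t : Fin T) (x u : State D) :
    ∫⁻ y, ENNReal.ofReal (F.propDensity δ t x u y) = 1 :=
  lintegral_gaussDensity _ (F.propCov_posDef δ hδ t x)

theorem Q_pos (t : Fin T) (x y : State D) : 0 < F.Q t x y :=
  mul_pos (gaussDensity_pos _ (F.posDef_C t x) y) (F.pos_G t x y)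

theorem potential_pos (hδ : ∀ t, 0 < δ t) (t : Fin T) (x y u : State D) :
    0 < F.potential κ δ t x y u :=
  div_pos (mul_pos (F.Q_pos t x y) (gaussDensity_pos _ (auxCov_posDef δ hδ t) u))
    (F.propDensity_pos δ hδ t x u y)

theorem auxQ_pos (hδ : ∀ t, 0 < δ t) (t : Fin T) (x y u : State D) : 0 < F.auxQ κ δ t x y u :=
  mul_pos (F.propDensity_pos δ hδ t x u y) (F.potential_pos κ δ hδ t x y u)

/-- The proposal density cancels. This is the identity on which invariance rests: Q' is at once the
model with its auxiliary variable and the proposal with its potential. -/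
theorem auxQ_eq (hδ : ∀ t, 0 < δ t) (t : Fin T) (x y u : State D) :
    F.auxQ κ δ t x y u = F.Q t x y * gaussDensity (F.auxMean κ δ t x y) (auxCov δ t) u := by
  have := (F.propDensity_pos δ hδ t x u y).ne'
  unfold auxQ potential
  field_simp

/-- The proposal is the conditional law of the state given the previous state and a Gaussian
pseudo-observation. -/
theorem propDensity_eq_posterior (hδ : ∀ t, 0 < δ t) (t : Fin T) (x u y : State D) :
    F.propDensity δ t x u y = F.M t x y * gaussDensity y (auxCov δ t) u /
      ∫ z, F.M t x z * gaussDensity z (auxCov δ t) u := by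
  obtain ⟨c, hc, h⟩ := gaussDensity_mul_gaussDensity (F.m t x) u (F.posDef_C t x) (half_pos (hδ t))
  have h' : ∀ z, F.M t x z * gaussDensity z (auxCov δ t) u = c * F.propDensity δ t x u z := h
  -- The posterior density has integral one, so the constant c of the completed square is the
  -- denominator.
  have hint : ∫ z, F.propDensity δ t x u z = 1 := by
    rw [integral_eq_lintegral_of_nonneg_ae
      (Filter.Eventually.of_forall fun z => (F.propDensity_pos δ hδ t x u z).le)
      (continuous_gaussDensity _ _).aestronglyMeasurable, F.lintegral_propDensity δ hδ]
    simp
  simp only [h', integral_const_mul, hint]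
  field_simp

variable {α : Type*} [MeasurableSpace α]

theorem measurable_A (t : Fin T) (i j : Fin D) : Measurable fun x => F.A δ t x i j :=
  measurable_matrix_mul (measurable_matrix_inv fun i j => (F.measurable_C t i j).add_const _)
    (F.measurable_C t) i j

theorem measurable_propCov (t : Fin T) (i j : Fin D) : Measurable fun x => F.propCov δ t x i j :=
  measurable_matrix_mul (fun i j => (F.measurable_A δ t i j).const_sub _) (F.measurable_C t) i j

theorem measurable_propMean (t : Fin T) :
    Measurable fun p : State D × State D => F.propMean δ t p.1 p.2 := by
  have hm : Measurable fun p : State D × State D => F.m t p.1 :=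
    (F.measurable_m t).comp measurable_fst
  exact hm.add ((WithLp.measurable_toLp 2 _).comp (measurable_mulVec
    (fun i j => (F.measurable_A δ t i j).comp measurable_fst)
    ((WithLp.measurable_ofLp 2 _).comp (measurable_snd.sub hm))))

@[fun_prop]
theorem measurable_propDensity (t : Fin T) {x u y : α → State D} (hx : Measurable x)
    (hu : Measurable u) (hy : Measurable y) :
    Measurable fun a => F.propDensity δ t (x a) (u a) (y a) :=
  measurable_gaussDensity ((F.measurable_propMean δ t).comp (hx.prodMk hu))
    (fun i j => (F.measurable_propCov δ t i j).comp hx) hy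

@[fun_prop]
theorem measurable_Q (t : Fin T) {x y : α → State D} (hx : Measurable x) (hy : Measurable y) :
    Measurable fun a => F.Q t (x a) (y a) :=
  (measurable_gaussDensity ((F.measurable_m t).comp hx)
    (fun i j => (F.measurable_C t i j).comp hx) hy).mul
    ((F.measurable_G t).comp (hx.prodMk hy))

@[fun_prop]
theorem measurable_auxMean (t : Fin T) {x y : α → State D} (hx : Measurable x)
    (hy : Measurable y) : Measurable fun a => F.auxMean κ δ t (x a) (y a) := by
  have h := measurable_gradient_right (f := fun x z => Real.log (F.G t x z))
    (F.measurable_G t).log fun x => (F.differentiable_G t x).log fun z => (F.pos_G t x z).ne'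
  have h' : Measurable fun a => gradient (fun z => Real.log (F.G t (x a) z)) (y a) :=
    h.comp (hx.prodMk hy)
  exact hy.add (h'.const_smul (κ * (δ t / 2)))

@[fun_prop]
theorem measurable_auxDensity (t : Fin T) {x y u : α → State D} (hx : Measurable x)
    (hy : Measurable y) (hu : Measurable u) :
    Measurable fun a => gaussDensity (F.auxMean κ δ t (x a) (y a)) (auxCov δ t) (u a) :=
  measurable_gaussDensity (F.measurable_auxMean κ δ t hx hy) (fun _ _ => measurable_const) hu

@[fun_prop]
theorem measurable_potential (t : Fin T) {x y u : α → State D} (hx : Measurable x)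
    (hy : Measurable y) (hu : Measurable u) :
    Measurable fun a => F.potential κ δ t (x a) (y a) (u a) :=
  ((F.measurable_Q t hx hy).mul (F.measurable_auxDensity κ δ t hx hy hu)).div
    (F.measurable_propDensity δ t hx hu hy)

@[fun_prop]
theorem measurable_auxQ (t : Fin T) {x y u : α → State D} (hx : Measurable x)
    (hy : Measurable y) (hu : Measurable u) :
    Measurable fun a => F.auxQ κ δ t (x a) (y a) (u a) :=
  (F.measurable_propDensity δ t hx hu hy).mul (F.measurable_potential κ δ t hx hy hu)

end Model

/-! ### Records of a time step, and a fictitious record before the first one -/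

namespace Slot

variable {D N : ℕ} {α : Type*} [MeasurableSpace α]

/-- All weights are positive, and they sum to one. -/
def IsNormalized (s : Slot D N) : Prop := (∀ n, 0 < weight s n) ∧ ∑ n, weight s n = 1

/-- A time step before the first one, with the dummy predecessor `0` as its particles and all of
the weight on the reference index `0`. -/
def origin (D N : ℕ) : Slot D N := (0, fun _ => 0, Pi.single 0 1, 0)

/-- The last recorded time step, or `origin` if there is none. -/
def lastOrOrigin : {t : ℕ} → (Fin t → Slot D N) → Slot D N
  | 0, _ => origin D N
  | t + 1, H => H (Fin.last t)

/-- Forget the index of the reference particle. -/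
def erase (s : Slot D N) : Slot D N := (s.1, s.2.1, s.2.2.1, 0)

@[fun_prop]
theorem measurable_aux {s : α → Slot D N} (hs : Measurable s) : Measurable fun a => aux (s a) :=
  measurable_fst.comp hs

@[fun_prop]
theorem measurable_particle {s : α → Slot D N} (hs : Measurable s) (n : Fin (N + 1)) :
    Measurable fun a => particle (s a) n :=
  (measurable_pi_apply n).comp (measurable_fst.comp (measurable_snd.comp hs))

@[fun_prop]
theorem measurable_weight {s : α → Slot D N} (hs : Measurable s) (n : Fin (N + 1)) :
    Measurable fun a => weight (s a) n :=
  (measurable_pi_apply n).comp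
    (measurable_fst.comp (measurable_snd.comp (measurable_snd.comp hs)))

@[fun_prop]
theorem measurable_ref {s : α → Slot D N} (hs : Measurable s) : Measurable fun a => ref (s a) :=
  measurable_snd.comp (measurable_snd.comp (measurable_snd.comp hs))

@[fun_prop]
theorem measurable_erase {s : α → Slot D N} (hs : Measurable s) :
    Measurable fun a => erase (s a) := by
  unfold erase
  fun_prop

@[fun_prop]
theorem measurable_lastOrOrigin {t : ℕ} {H : α → Fin t → Slot D N} (hH : Measurable H) :
    Measurable fun a => lastOrOrigin (H a) := by
  cases t with
  | zero => exact measurable_const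
  | succ t => exact (measurable_pi_apply (Fin.last t)).comp hH

theorem measurableSet_isNormalized : MeasurableSet {s : Slot D N | IsNormalized s} := by
  have h : {s : Slot D N | IsNormalized s} =
      (⋂ n, {s | 0 < weight s n}) ∩ {s | ∑ n, weight s n = 1} := by
    ext s
    simp [IsNormalized]
  rw [h]
  refine (MeasurableSet.iInter fun n => measurableSet_lt measurable_const
    (measurable_weight measurable_id n)).inter (measurableSet_eq_fun ?_ measurable_const)
  exact Finset.measurable_sum _ fun n _ => measurable_weight measurable_id n

theorem particle_last {t : ℕ} (H : Fin t → Slot D N) :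
    particle (last H) = particle (lastOrOrigin H) := by
  cases t <;> rfl

/-- Strict positivity fails for `origin`, whose weights vanish off the index 0. Nonnegative weights
with sum one are what holds at every time, including before the first step. -/
theorem weight_lastOrOrigin {t : ℕ} {H : Fin t → Slot D N} (hH : ∀ i, IsNormalized (H i)) :
    (∀ n, 0 ≤ weight (lastOrOrigin H) n) ∧ ∑ n, weight (lastOrOrigin H) n = 1 := by
  cases t with
  | zero =>
    refine ⟨fun n => ?_, ?_⟩
    · by_cases h : n = 0 <;> simp [lastOrOrigin, origin, weight, h]
    · simp [lastOrOrigin, origin, weight]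
  | succ t => exact ⟨fun n => ((hH _).1 n).le, (hH _).2⟩

end Slot

theorem measurable_snoc {α β : Type*} [MeasurableSpace α] [MeasurableSpace β] {t : ℕ}
    {H : α → Fin t → β} {s : α → β} (hH : Measurable H) (hs : Measurable s) :
    Measurable fun a => (Fin.snoc (α := fun _ => β) (H a) (s a) : Fin (t + 1) → β) := by
  refine measurable_pi_iff.2 fun i => ?_
  induction i using Fin.lastCases with
  | last => simpa using hs
  | cast i => simpa using! (measurable_pi_apply i).comp hH

theorem measurable_update_apply {ι α β : Type*} [DecidableEq ι] [MeasurableSpace α]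
    [MeasurableSpace β] {z : α → ι → β} {y : α → β} (k : ι) (hz : Measurable z)
    (hy : Measurable y) : Measurable fun a => Function.update (z a) k (y a) := by
  refine measurable_pi_iff.2 fun i => ?_
  rcases eq_or_ne i k with rfl | h
  · simpa using hy
  · simpa [h] using! (measurable_pi_apply i).comp hz

/-! ### One step of the forward pass as an explicit integral -/

section Step

variable {D T N : ℕ} (F : Model D T) (κ : ℝ) (δ : Fin T → ℝ)
variable {α : Type*} [MeasurableSpace α]

/-- Probability of the ancestor indices `a` if the reference index `k` has ancestor `k₀`, and the
others have independent ancestors with weights `W`. -/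
def parentProb (W : Fin (N + 1) → ℝ) (k₀ k : Fin (N + 1)) (a : Fin (N + 1) → Fin (N + 1)) : ℝ :=
  ∏ n, if n = k then (if a n = k₀ then 1 else 0) else W (a n)

/-- With all the weight of `origin` on index 0, ordinary resampling produces the dummy ancestors of
the first step almost surely. The first step therefore needs no separate treatment afterwards. -/
theorem ancestorProb_last {t : ℕ} (ht : t < T) (H : Fin t → Slot D N) (k : Fin (N + 1))
    (a : Fin (N + 1) → Fin (N + 1)) :
    ancestorProb (⟨t, ht⟩ : Fin T) (Slot.last H) k a =
      parentProb (Slot.weight (Slot.lastOrOrigin H)) (Slot.ref (Slot.lastOrOrigin H)) k a := by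
  cases t with
  | succ t => exact if_pos t.succ_pos
  | zero =>
    simp only [ancestorProb, lt_irrefl, if_false, parentProb, Slot.lastOrOrigin, Slot.origin,
      Slot.weight, Slot.ref]
    by_cases ha : a = fun _ => 0
    · simp [ha]
    · rw [if_neg ha]
      obtain ⟨n, hn⟩ := Function.ne_iff.1 ha
      refine (Finset.prod_eq_zero (Finset.mem_univ n) ?_).symm
      simp [hn]

/-- The weights depend on the previous step only through its particles. -/
theorem normWeights_congr (t : Fin T) {s s' : Slot D N}
    (h : Slot.particle s = Slot.particle s') : normWeights F κ δ t s = normWeights F κ δ t s' := by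
  funext a u y n
  simp only [normWeights, h]

@[fun_prop]
theorem measurable_normWeights (t : Fin T) (a : Fin (N + 1) → Fin (N + 1)) {s : α → Slot D N}
    {u : α → State D} {y : α → Fin (N + 1) → State D} (hs : Measurable s) (hu : Measurable u)
    (hy : Measurable y) : Measurable fun b => normWeights F κ δ t (s b) a (u b) (y b) := by
  refine measurable_pi_iff.2 fun n => ?_
  unfold normWeights
  have h : ∀ j, Measurable fun b => F.potential κ δ t (Slot.particle (s b) (a j)) (y b j) (u b) :=
    fun j => F.measurable_potential κ δ t (by fun_prop) ((measurable_pi_apply j).comp hy) hu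
  exact (h n).div (Finset.measurable_sum _ fun j _ => h j)

theorem isNormalized_normWeights (hδ : ∀ t, 0 < δ t) (t : Fin T) (s : Slot D N)
    (a : Fin (N + 1) → Fin (N + 1)) (u : State D) (y : Fin (N + 1) → State D) (k : Fin (N + 1)) :
    Slot.IsNormalized ((u, y, normWeights F κ δ t s a u y, k) : Slot D N) := by
  have hp := fun j => F.potential_pos κ δ hδ t (Slot.particle s (a j)) (y j) u
  have hs : 0 < ∑ j, F.potential κ δ t (Slot.particle s (a j)) (y j) u :=
    Finset.sum_pos (fun j _ => hp j) Finset.univ_nonempty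
  refine ⟨fun n => div_pos (hp n) hs, ?_⟩
  simp only [Slot.weight, normWeights, ← Finset.sum_div]
  exact div_self hs.ne'

/-- The joint density of the particles proposed from the ancestors `a`. -/
def proposalDensity (t : Fin T) (s : Slot D N) (a : Fin (N + 1) → Fin (N + 1)) (u : State D)
    (z : Fin (N + 1) → State D) : ENNReal :=
  ∏ n, ENNReal.ofReal (F.propDensity δ t (Slot.particle s (a n)) u (z n))

@[fun_prop]
theorem measurable_proposalDensity (t : Fin T) (a : Fin (N + 1) → Fin (N + 1)) {s : α → Slot D N}
    {u : α → State D} {z : α → Fin (N + 1) → State D} (hs : Measurable s) (hu : Measurable u)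
    (hz : Measurable z) : Measurable fun b => proposalDensity F δ t (s b) a (u b) (z b) :=
  Finset.measurable_prod _ fun n _ => (F.measurable_propDensity δ t (by fun_prop) hu
    ((measurable_pi_apply n).comp hz)).ennreal_ofReal

/-- The proposed particles before the reference state is put in place. -/
theorem pi_propLaw (hδ : ∀ t, 0 < δ t) (t : Fin T) (s : Slot D N)
    (a : Fin (N + 1) → Fin (N + 1)) (u : State D) :
    Measure.pi (fun n => F.propLaw δ t (Slot.particle s (a n)) u) =
      volume.withDensity (proposalDensity F δ t s a u) := by
  have h : ∀ n, F.propLaw δ t (Slot.particle s (a n)) u =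
      volume.withDensity fun y =>
        ENNReal.ofReal (F.propDensity δ t (Slot.particle s (a n)) u y) :=
    fun n => F.propLaw_eq_withDensity δ hδ t _ u
  have : ∀ n, IsProbabilityMeasure ((volume : Measure (State D)).withDensity fun y =>
      ENNReal.ofReal (F.propDensity δ t (Slot.particle s (a n)) u y)) := by
    intro n
    rw [← h]
    unfold Model.propLaw
    infer_instance
  simp only [h]
  exact pi_withDensity volume _ fun n => (by fun_prop)

theorem lintegral_pi_propLaw (hδ : ∀ t, 0 < δ t) (t : Fin T) (s : Slot D N)
    (a : Fin (N + 1) → Fin (N + 1)) (u : State D) {g : (Fin (N + 1) → State D) → ENNReal}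
    (hg : Measurable g) :
    ∫⁻ z, g z ∂Measure.pi (fun n => F.propLaw δ t (Slot.particle s (a n)) u) =
      ∫⁻ z, proposalDensity F δ t s a u z * g z := by
  rw [pi_propLaw F δ hδ, lintegral_withDensity_eq_lintegral_mul _ (by fun_prop) hg]
  rfl

instance (t : Fin T) (x u : State D) : IsProbabilityMeasure (F.propLaw δ t x u) := by
  unfold Model.propLaw
  infer_instance

/-- The law has a point mass at the reference coordinate and hence no density. Drawing all particles
from the proposal and then overwriting coordinate k gives the same law, in terms of a density that
does not involve k. -/
theorem lintegral_particleLaw (hδ : ∀ t, 0 < δ t) (x : Path D T) (t : Fin T) (s : Slot D N)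
    (k : Fin (N + 1)) (a : Fin (N + 1) → Fin (N + 1)) (u : State D)
    {g : (Fin (N + 1) → State D) → ENNReal} (hg : Measurable g) :
    ∫⁻ y, g y ∂particleLaw F δ x t s k a u =
      ∫⁻ z, proposalDensity F δ t s a u z * g (Function.update z k (x t)) := by
  unfold particleLaw
  rw [pi_update_dirac, lintegral_map hg (by fun_prop), lintegral_pi_propLaw F δ hδ]
  exact hg.comp (by fun_prop)

/-- The integral of `h` over the records of time step `t` if the previous record is `s` with
reference index `k₀`, and the reference path moves from `x` to `y`. -/
def stepIntegral (t : Fin T) (s : Slot D N) (k₀ : Fin (N + 1)) (x y : State D)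
    (h : Slot D N → ENNReal) : ENNReal :=
  ∑ k : Fin (N + 1), ((N : ENNReal) + 1)⁻¹ *
    ∑ a : Fin (N + 1) → Fin (N + 1), ENNReal.ofReal (parentProb (Slot.weight s) k₀ k a) *
      ∫⁻ u, ENNReal.ofReal (gaussDensity (F.auxMean κ δ t x y) (Model.auxCov δ t) u) *
        ∫⁻ z, proposalDensity F δ t s a u z *
          h (u, Function.update z k y, normWeights F κ δ t s a u (Function.update z k y), k)

theorem measurable_stepIntegral (t : Fin T) {s : α → Slot D N} {k₀ : α → Fin (N + 1)}
    {x y : α → State D} {h : α → Slot D N → ENNReal} (hs : Measurable s) (hk : Measurable k₀)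
    (hx : Measurable x) (hy : Measurable y) (hh : Measurable (Function.uncurry h)) :
    Measurable fun b => stepIntegral F κ δ t (s b) (k₀ b) (x b) (y b) (h b) := by
  unfold stepIntegral
  refine Finset.measurable_sum _ fun k _ => Measurable.const_mul
    (Finset.measurable_sum _ fun a _ => Measurable.mul (Measurable.ennreal_ofReal ?_) ?_) _
  · refine Finset.measurable_prod _ fun n _ => ?_
    split_ifs
    · exact (measurable_of_countable fun j => if a n = j then (1 : ℝ) else 0).comp hk
    · fun_prop
  · refine Measurable.lintegral_prod_right ?_
    simp only [Function.uncurry_def]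
    refine Measurable.mul ?_ ?_
    · fun_prop
    · refine Measurable.lintegral_prod_right ?_
      simp only [Function.uncurry_def]
      refine Measurable.mul ?_ ?_
      · fun_prop
      · have hu : Measurable fun q : (α × State D) × (Fin (N + 1) → State D) =>
            Function.update q.2 k (y q.1.1) :=
          measurable_update_apply k measurable_snd (hy.comp (measurable_fst.comp measurable_fst))
        have hw : Measurable fun q : (α × State D) × (Fin (N + 1) → State D) =>
            normWeights F κ δ t (s q.1.1) a q.1.2 (Function.update q.2 k (y q.1.1)) :=
          measurable_normWeights F κ δ t a (by fun_prop) (by fun_prop) hu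
        exact hh.comp ((measurable_fst.comp measurable_fst).prodMk
          ((measurable_snd.comp measurable_fst).prodMk (hu.prodMk (hw.prodMk measurable_const))))

/-- The integral evaluates its argument only at records with normalised weights whose reference
particle is the new state y; this is how almost sure properties of the records are established. -/
theorem stepIntegral_congr (hδ : ∀ t, 0 < δ t) (t : Fin T) (s : Slot D N) (k₀ : Fin (N + 1))
    (x y : State D) {h h' : Slot D N → ENNReal}
    (hh : ∀ s' : Slot D N, Slot.IsNormalized s' → Slot.particle s' (Slot.ref s') = y →
      h s' = h' s') :
    stepIntegral F κ δ t s k₀ x y h = stepIntegral F κ δ t s k₀ x y h' := by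
  unfold stepIntegral
  refine Finset.sum_congr rfl fun k _ => ?_
  congr 1
  refine Finset.sum_congr rfl fun a _ => ?_
  congr 1
  refine lintegral_congr fun u => ?_
  congr 1
  refine lintegral_congr fun z => ?_
  rw [hh _ (isNormalized_normWeights F κ δ hδ t s a u _ k)]
  simp [Slot.particle, Slot.ref]

theorem sum_prod_apply {ι : Type*} [Fintype ι] [DecidableEq ι] {β : Type*} [Fintype β]
    {R : Type*} [CommSemiring R] (f : ι → β → R) :
    ∑ a : ι → β, ∏ n, f n (a n) = ∏ n, ∑ b, f n b := by
  classical
  rw [Finset.prod_univ_sum, Fintype.piFinset_univ]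

theorem sum_parentProb {W : Fin (N + 1) → ℝ} (hW : ∑ n, W n = 1) (k₀ k : Fin (N + 1)) :
    ∑ a, parentProb W k₀ k a = 1 := by
  unfold parentProb
  rw [sum_prod_apply (fun n b => if n = k then (if b = k₀ then (1 : ℝ) else 0) else W b)]
  refine Finset.prod_eq_one fun n _ => ?_
  by_cases h : n = k <;> simp [h, hW]

theorem parentProb_nonneg {W : Fin (N + 1) → ℝ} (hW : ∀ n, 0 ≤ W n) (k₀ k : Fin (N + 1))
    (a : Fin (N + 1) → Fin (N + 1)) : 0 ≤ parentProb W k₀ k a :=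
  Finset.prod_nonneg fun n _ => by
    split_ifs
    exacts [zero_le_one, le_rfl, hW _]

theorem lintegral_proposalDensity (hδ : ∀ t, 0 < δ t) (t : Fin T) (s : Slot D N)
    (a : Fin (N + 1) → Fin (N + 1)) (u : State D) : ∫⁻ z, proposalDensity F δ t s a u z = 1 := by
  have h := lintegral_pi_propLaw F δ hδ t s a u (g := fun _ => 1) measurable_const
  simpa using h.symm

theorem inv_mul_sum_one : ∑ _k : Fin (N + 1), ((N : ENNReal) + 1)⁻¹ = 1 := by
  rw [Finset.sum_const, Finset.card_univ, Fintype.card_fin, nsmul_eq_mul]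
  push_cast
  exact ENNReal.mul_inv_cancel (by simp) (by finiteness)

theorem stepIntegral_one (hδ : ∀ t, 0 < δ t) (t : Fin T) {s : Slot D N} (k₀ : Fin (N + 1))
    (x y : State D) (hs : (∀ n, 0 ≤ Slot.weight s n) ∧ ∑ n, Slot.weight s n = 1) :
    stepIntegral F κ δ t s k₀ x y (fun _ => 1) = 1 := by
  unfold stepIntegral
  simp only [mul_one, lintegral_proposalDensity F δ hδ,
    lintegral_gaussDensity _ (Model.auxCov_posDef δ hδ t)]
  simp_rw [← ENNReal.ofReal_sum_of_nonneg fun a _ => parentProb_nonneg hs.1 _ _ a,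
    sum_parentProb hs.2, ENNReal.ofReal_one, mul_one]
  exact inv_mul_sum_one

/-- This replaces the measure by an explicit formula, in which `origin` takes the place of `init`
and measurability in all arguments can be read off. -/
theorem lintegral_stepLaw (hδ : ∀ t, 0 < δ t) (x : Path D T) {t : ℕ} (ht : t < T)
    (H : Fin t → Slot D N) {h : Slot D N → ENNReal} (hh : Measurable h) :
    ∫⁻ s, h s ∂stepLaw F κ δ x ⟨t, ht⟩ (Slot.last H) =
      stepIntegral F κ δ ⟨t, ht⟩ (Slot.lastOrOrigin H) (Slot.ref (Slot.lastOrOrigin H))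
        (pred x ⟨t, ht⟩) (x ⟨t, ht⟩) h := by
  have hn := normWeights_congr F κ δ ⟨t, ht⟩ (Slot.particle_last H)
  have hp : proposalDensity F δ ⟨t, ht⟩ (Slot.last H) =
      proposalDensity F δ ⟨t, ht⟩ (Slot.lastOrOrigin H) := by
    funext a u z
    simp only [proposalDensity, Slot.particle_last]
  set τ : Fin T := ⟨t, ht⟩
  unfold stepLaw stepIntegral
  rw [lintegral_finsetSum_measure]
  refine Finset.sum_congr rfl fun k _ => ?_
  rw [lintegral_smul_measure, lintegral_finsetSum_measure, smul_eq_mul]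
  congr 1
  refine Finset.sum_congr rfl fun a _ => ?_
  rw [lintegral_smul_measure, smul_eq_mul, ancestorProb_last]
  congr 1
  have hf : ∀ u, Measurable fun y => ((u, y, normWeights F κ δ τ (Slot.last H) a u y, k) :
      Slot D N) := fun u => by fun_prop
  have hinner : ∀ (u : State D) {g : Slot D N → ENNReal}, Measurable g →
      ∫⁻ s, g s ∂(particleLaw F δ x τ (Slot.last H) k a u).map
        (fun y => (u, y, normWeights F κ δ τ (Slot.last H) a u y, k)) =
      ∫⁻ z, proposalDensity F δ τ (Slot.lastOrOrigin H) a u z *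
          g (u, Function.update z k (x τ),
            normWeights F κ δ τ (Slot.lastOrOrigin H) a u (Function.update z k (x τ)), k) := by
    intro u g hg
    rw [lintegral_map hg (hf u)]
    refine (lintegral_particleLaw F δ hδ x τ _ k a u (hg.comp (hf u))).trans ?_
    rw [hp, hn]
    rfl
  have hm : ∀ {g : Slot D N → ENNReal}, Measurable g → Measurable fun u =>
      ∫⁻ z, proposalDensity F δ τ (Slot.lastOrOrigin H) a u z *
          g (u, Function.update z k (x τ),
            normWeights F κ δ τ (Slot.lastOrOrigin H) a u (Function.update z k (x τ)), k) := by
    intro g hg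
    refine Measurable.lintegral_prod_right ?_
    simp only [Function.uncurry_def]
    refine Measurable.mul (by fun_prop) ?_
    exact hg.comp (f := fun q : State D × (Fin (N + 1) → State D) =>
      (q.1, Function.update q.2 k (x τ), normWeights F κ δ τ (Slot.lastOrOrigin H) a q.1
            (Function.update q.2 k (x τ)), k)) (by fun_prop)
  -- Integrals against `bind` need a measurable family of laws; this comes from the explicit formula
  -- applied to indicators.
  have hmeas : Measurable fun u => (particleLaw F δ x τ (Slot.last H) k a u).map
      (fun y => ((u, y, normWeights F κ δ τ (Slot.last H) a u y, k) : Slot D N)) := by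
    refine Measure.measurable_of_measurable_coe _ fun A hA => ?_
    have hA1 : Measurable (A.indicator fun _ => (1 : ENNReal)) := measurable_const.indicator hA
    have := hm hA1
    simp only [← hinner _ hA1, lintegral_indicator hA, lintegral_one,
      Measure.restrict_apply MeasurableSet.univ, Set.univ_inter] at this
    exact this
  rw [Measure.lintegral_bind hmeas.aemeasurable hh.aemeasurable]
  simp only [hinner _ hh]
  rw [auxLaw, multivariateGaussian_eq_withDensity _ (Model.auxCov_posDef δ hδ τ),
    lintegral_withDensity_eq_lintegral_mul _
      (continuous_gaussDensity _ _).measurable.ennreal_ofReal (hm hh)]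
  rfl

end Step

/-! ### The forward pass: recursion, almost sure properties, measurability -/

section Forward

variable {D T N : ℕ} (F : Model D T) (κ : ℝ) (δ : Fin T → ℝ)

@[fun_prop]
theorem measurable_pred {α : Type*} [MeasurableSpace α] (t : Fin T) {x : α → Path D T}
    (hx : Measurable x) : Measurable fun a => pred (x a) t := by
  unfold pred
  split_ifs <;> fun_prop

/-- The law of the next history, given the history `H` so far. -/
def extendLaw (x : Path D T) (t : Fin T) (H : Fin t → Slot D N) :
    Measure (Fin (t + 1) → Slot D N) :=
  (stepLaw F κ δ x t (Slot.last H)).map fun s => Fin.snoc (α := fun _ => Slot D N) H s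

theorem lintegral_extendLaw (hδ : ∀ t, 0 < δ t) (x : Path D T) {t : ℕ} (ht : t < T)
    (H : Fin t → Slot D N) {g : (Fin (t + 1) → Slot D N) → ENNReal} (hg : Measurable g) :
    ∫⁻ H', g H' ∂extendLaw F κ δ x ⟨t, ht⟩ H =
      stepIntegral F κ δ ⟨t, ht⟩ (Slot.lastOrOrigin H) (Slot.ref (Slot.lastOrOrigin H))
        (pred x ⟨t, ht⟩) (x ⟨t, ht⟩) fun s => g (Fin.snoc (α := fun _ => Slot D N) H s) := by
  have hs : Measurable fun s : Slot D N => Fin.snoc (α := fun _ => Slot D N) H s :=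
    measurable_snoc measurable_const measurable_id
  unfold extendLaw
  rw [lintegral_map hg hs]
  exact lintegral_stepLaw F κ δ hδ x ht H (hg.comp hs)

theorem measurable_lintegral_extendLaw {α : Type*} [MeasurableSpace α] (hδ : ∀ t, 0 < δ t)
    {t : ℕ} (ht : t < T) {x : α → Path D T} {H : α → Fin t → Slot D N} (hx : Measurable x)
    (hH : Measurable H) {g : (Fin (t + 1) → Slot D N) → ENNReal} (hg : Measurable g) :
    Measurable fun a => ∫⁻ H', g H' ∂extendLaw F κ δ (x a) ⟨t, ht⟩ (H a) := by
  simp only [lintegral_extendLaw F κ δ hδ _ ht _ hg]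
  refine measurable_stepIntegral F κ δ _ (by fun_prop) (by fun_prop) (by fun_prop) (by fun_prop) ?_
  exact hg.comp (measurable_snoc (hH.comp measurable_fst) measurable_snd)

theorem measurable_extendLaw {α : Type*} [MeasurableSpace α] (hδ : ∀ t, 0 < δ t)
    {t : ℕ} (ht : t < T) {x : α → Path D T} {H : α → Fin t → Slot D N} (hx : Measurable x)
    (hH : Measurable H) : Measurable fun a => extendLaw F κ δ (x a) ⟨t, ht⟩ (H a) := by
  refine Measure.measurable_of_measurable_coe _ fun A hA => ?_
  have h := measurable_lintegral_extendLaw F κ δ hδ ht hx hH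
    (measurable_const.indicator hA : Measurable (A.indicator fun _ => (1 : ENNReal)))
  simpa only [lintegral_indicator hA, lintegral_one, Measure.restrict_apply MeasurableSet.univ,
    Set.univ_inter] using h

theorem forwardLaw_succ (x : Path D T) (t : ℕ) (h : t + 1 ≤ T) :
    forwardLaw F κ δ N x (t + 1) h =
      (forwardLaw F κ δ N x t (Nat.le_of_succ_le h)).bind (extendLaw F κ δ x ⟨t, h⟩) := rfl

/-- Conditioning on the history before the last time step. -/
theorem lintegral_forwardLaw_succ (hδ : ∀ t, 0 < δ t) (x : Path D T) (t : ℕ) (ht : t + 1 ≤ T)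
    {g : (Fin (t + 1) → Slot D N) → ENNReal} (hg : Measurable g) :
    ∫⁻ H', g H' ∂forwardLaw F κ δ N x (t + 1) ht =
      ∫⁻ H, stepIntegral F κ δ ⟨t, ht⟩ (Slot.lastOrOrigin H) (Slot.ref (Slot.lastOrOrigin H))
        (pred x ⟨t, ht⟩) (x ⟨t, ht⟩) (fun s => g (Fin.snoc (α := fun _ => Slot D N) H s))
        ∂forwardLaw F κ δ N x t (Nat.le_of_succ_le ht) := by
  have hm : Measurable (extendLaw (N := N) F κ δ x ⟨t, ht⟩) :=
    measurable_extendLaw F κ δ hδ ht measurable_const measurable_id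
  rw [forwardLaw_succ, Measure.lintegral_bind hm.aemeasurable hg.aemeasurable]
  exact lintegral_congr fun H => lintegral_extendLaw F κ δ hδ x ht H hg

theorem lintegral_forwardLaw_zero (x : Path D T) {g : (Fin 0 → Slot D N) → ENNReal} :
    ∫⁻ H, g H ∂forwardLaw F κ δ N x 0 (Nat.zero_le T) = g fun i => i.elim0 := by
  unfold forwardLaw
  exact lintegral_dirac' _ Subsingleton.measurable

/-- A history that is possible along the reference path `x`: all weights are normalised, and the
reference particles are the states of `x`. -/
def IsAdmissible (x : Path D T) {t : ℕ} (ht : t ≤ T) (H : Fin t → Slot D N) : Prop :=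
  ∀ i, Slot.IsNormalized (H i) ∧
    Slot.particle (H i) (Slot.ref (H i)) = x (Fin.castLE ht i)

theorem measurableSet_isAdmissible (x : Path D T) {t : ℕ} (ht : t ≤ T) :
    MeasurableSet {H : Fin t → Slot D N | IsAdmissible x ht H} := by
  have h : {H : Fin t → Slot D N | IsAdmissible x ht H} =
      ⋂ i, (fun H => H i) ⁻¹' ({s | Slot.IsNormalized s} ∩
        {s | Slot.particle s (Slot.ref s) = x (Fin.castLE ht i)}) := by
    ext H
    simp [IsAdmissible]
  rw [h]
  refine MeasurableSet.iInter fun i => measurable_pi_apply i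
    (Slot.measurableSet_isNormalized.inter (measurableSet_eq_fun ?_ measurable_const))
  have : Measurable fun p : (Fin (N + 1) → State D) × Fin (N + 1) => p.1 p.2 :=
    measurable_from_prod_countable_left fun k => measurable_pi_apply k
  exact this.comp (f := fun s : Slot D N => (s.2.1, s.2.2.2)) (by fun_prop)

theorem isAdmissible_snoc (x : Path D T) {t : ℕ} (ht : t + 1 ≤ T) {H : Fin t → Slot D N}
    {s : Slot D N} (hH : IsAdmissible x (Nat.le_of_succ_le ht) H) (hs : Slot.IsNormalized s)
    (hp : Slot.particle s (Slot.ref s) = x ⟨t, ht⟩) :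
    IsAdmissible x ht (Fin.snoc (α := fun _ => Slot D N) H s) := by
  intro i
  induction i using Fin.lastCases with
  | last => simpa using ⟨hs, hp⟩
  | cast i => simpa using hH i

/-- Arbitrary records may carry meaningless weights, for which the selection probabilities need not
add up to one. Such histories are shown to be null, by integrating the indicator of the complement
through the recursion. -/
theorem forwardLaw_ae (hδ : ∀ t, 0 < δ t) (x : Path D T) (t : ℕ) (ht : t ≤ T) :
    ∀ᵐ H ∂forwardLaw F κ δ N x t ht, IsAdmissible x ht H := by
  induction t with
  | zero => exact Filter.Eventually.of_forall fun H i => i.elim0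
  | succ t ih =>
    have hA := (measurableSet_isAdmissible (N := N) x ht).compl
    rw [ae_iff]
    have hA1 : Measurable ({H : Fin (t + 1) → Slot D N | IsAdmissible x ht H}ᶜ.indicator
        fun _ => (1 : ENNReal)) := measurable_const.indicator hA
    have h := lintegral_forwardLaw_succ F κ δ hδ x t ht hA1
    rw [lintegral_indicator hA, lintegral_one, Measure.restrict_apply MeasurableSet.univ,
      Set.univ_inter] at h
    rw [show {H : Fin (t + 1) → Slot D N | ¬IsAdmissible x ht H} =
      {H | IsAdmissible x ht H}ᶜ from rfl, h]
    refine (lintegral_congr_ae ?_).trans lintegral_zero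
    filter_upwards [ih (Nat.le_of_succ_le ht)] with H hH
    rw [stepIntegral_congr F κ δ hδ _ _ _ _ _ (h' := fun _ => 0) fun s hs hp =>
      Set.indicator_of_notMem (not_not.2 (isAdmissible_snoc x ht hH hs hp)) _]
    simp [stepIntegral]

/-- The records of the first `t` time steps depend measurably on the reference path. -/
theorem measurable_forwardLaw (hδ : ∀ t, 0 < δ t) (t : ℕ) (ht : t ≤ T) :
    Measurable (fun x => forwardLaw F κ δ N x t ht) ∧
      ∀ x, IsProbabilityMeasure (forwardLaw F κ δ N x t ht) := by
  induction t with
  | zero =>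
    refine ⟨measurable_const, fun x => ?_⟩
    unfold forwardLaw
    infer_instance
  | succ t ih =>
    obtain ⟨hm, hP⟩ := ih (Nat.le_of_succ_le ht)
    let K : Kernel (Path D T) (Fin t → Slot D N) := ⟨_, hm⟩
    have hK : IsMarkovKernel K := ⟨hP⟩
    constructor
    · refine Measure.measurable_of_measurable_coe _ fun A hA => ?_
      simp only [forwardLaw_succ]
      have hb : ∀ x, (K x).bind (extendLaw F κ δ x ⟨t, ht⟩) A =
          ∫⁻ H, extendLaw F κ δ x ⟨t, ht⟩ H A ∂K x := fun x =>
        Measure.bind_apply hA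
          (measurable_extendLaw F κ δ hδ ht measurable_const measurable_id).aemeasurable
      have h2 : Measurable fun x => ∫⁻ H, extendLaw F κ δ x ⟨t, ht⟩ H A ∂K x :=
        Measurable.lintegral_kernel_prod_right (κ := K)
          ((Measure.measurable_coe hA).comp
            (measurable_extendLaw F κ δ hδ ht measurable_fst measurable_snd))
      simp only [← hb] at h2
      exact h2
    · intro x
      constructor
      have h := lintegral_forwardLaw_succ F κ δ (N := N) hδ x t ht (g := fun _ => 1)
        measurable_const
      rw [lintegral_one] at h
      rw [h]
      have := hP x
      refine (lintegral_congr_ae (g := fun _ => 1) ?_).trans (by simp)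
      filter_upwards [forwardLaw_ae F κ δ hδ x t (Nat.le_of_succ_le ht)] with H hH
      exact stepIntegral_one F κ δ hδ _ _ _ _ (Slot.weight_lastOrOrigin fun i => (hH i).1)

/-- The first `t` records depend on the reference path up to time `t` only. -/
theorem forwardLaw_congr {x x' : Path D T} (t : ℕ) (ht : t ≤ T)
    (h : ∀ i : Fin T, i.val < t → x i = x' i) :
    forwardLaw F κ δ N x t ht = forwardLaw F κ δ N x' t ht := by
  induction t with
  | zero => rfl
  | succ t ih =>
    rw [forwardLaw_succ, forwardLaw_succ, ih _ fun i hi => h i (by omega)]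
    congr 1
    have hp : pred x ⟨t, ht⟩ = pred x' ⟨t, ht⟩ := by
      unfold pred
      split_ifs
      · exact h _ (by simp)
      · rfl
    have ht' : x ⟨t, ht⟩ = x' ⟨t, ht⟩ := h _ (by simp)
    funext H
    simp only [extendLaw, stepLaw, auxLaw, particleLaw, hp, ht']

end Forward

/-- Once the reference state is itself drawn from the proposal, overwriting coordinate k with it
leaves the product law unchanged. This makes the reference particle indistinguishable from the
others. -/
theorem lintegral_pi_update {n : ℕ} {E : Type*} [MeasurableSpace E] (ν : Fin n → Measure E)
    [∀ i, IsProbabilityMeasure (ν i)] (k : Fin n) {g : (Fin n → E) → ENNReal} (hg : Measurable g) :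
    ∫⁻ y, ∫⁻ z, g (Function.update z k y) ∂Measure.pi ν ∂ν k = ∫⁻ z, g z ∂Measure.pi ν := by
  rw [← map_update_prod_pi ν k, lintegral_map hg measurable_update', map_update_prod_pi ν k]
  exact (lintegral_prod_symm _ (hg.comp measurable_update').aemeasurable).symm

/-- The marginal of one coordinate among independent ones: every other factor sums to one. -/
theorem sum_prod_mul_apply {ι β R : Type*} [Fintype ι] [DecidableEq ι] [Fintype β]
    [CommSemiring R] {w : β → R} (hw : ∑ b, w b = 1) (j : ι) (φ : β → R) :
    ∑ a : ι → β, (∏ n, w (a n)) * φ (a j) = ∑ b, w b * φ b := by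
  have h : ∀ a : ι → β, (∏ n, w (a n)) * φ (a j) =
      ∏ n, w (a n) * (if n = j then φ (a n) else 1) := by
    intro a
    rw [Finset.prod_mul_distrib, Finset.prod_ite_eq' Finset.univ j]
    simp
  simp_rw [h]
  rw [sum_prod_apply (fun n b => w b * (if n = j then φ b else 1)),
    ← Finset.mul_prod_erase _ _ (Finset.mem_univ j)]
  rw [Finset.prod_eq_one, mul_one]
  · simp
  · intro n hn
    simp [Finset.ne_of_mem_erase hn, hw]

/-! ### The particle system without a reference path; one step forward and one step back -/

section ParticleSystem

variable {D T N : ℕ} (F : Model D T) (κ : ℝ) (δ : Fin T → ℝ)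

/-- The integral of `h` over the records of time step `t` in the particle system without a
reference particle, reweighted by the sum of the unnormalised weights. -/
def systemStep (t : Fin T) (s : Slot D N) (h : Slot D N → ENNReal) : ENNReal :=
  ((N : ENNReal) + 1)⁻¹ * ∑ a : Fin (N + 1) → Fin (N + 1),
    (∏ n, ENNReal.ofReal (Slot.weight s (a n))) *
      ∫⁻ u, ∫⁻ z, proposalDensity F δ t s a u z *
        (ENNReal.ofReal (∑ j, F.potential κ δ t (Slot.particle s (a j)) (z j) u) *
          h (u, z, normWeights F κ δ t s a u z, 0))

theorem systemStep_congr (hδ : ∀ t, 0 < δ t) (t : Fin T) (s : Slot D N) {h h' : Slot D N → ENNReal}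
    (hh : ∀ s', Slot.IsNormalized s' → h s' = h' s') :
    systemStep F κ δ t s h = systemStep F κ δ t s h' := by
  unfold systemStep
  congr 1
  refine Finset.sum_congr rfl fun a _ => ?_
  congr 1
  refine lintegral_congr fun u => lintegral_congr fun z => ?_
  rw [hh _ (isNormalized_normWeights F κ δ hδ t s a u z 0)]

/-- The reason for the reweighting in `systemStep`: the total potential turns a draw from the
normalised weights into a sum weighted by the potentials themselves. -/
theorem sum_potential_mul_normWeights (hδ : ∀ t, 0 < δ t) (t : Fin T) (s : Slot D N)
    (a : Fin (N + 1) → Fin (N + 1)) (u : State D) (z : Fin (N + 1) → State D)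
    (φ : Fin (N + 1) → ENNReal) :
    ENNReal.ofReal (∑ j, F.potential κ δ t (Slot.particle s (a j)) (z j) u) *
        ∑ k, ENNReal.ofReal (normWeights F κ δ t s a u z k) * φ k =
      ∑ k, ENNReal.ofReal (F.potential κ δ t (Slot.particle s (a k)) (z k) u) * φ k := by
  have hp := fun j => F.potential_pos κ δ hδ t (Slot.particle s (a j)) (z j) u
  have hs : 0 < ∑ j, F.potential κ δ t (Slot.particle s (a j)) (z j) u :=
    Finset.sum_pos (fun j _ => hp j) Finset.univ_nonempty
  rw [Finset.mul_sum]
  refine Finset.sum_congr rfl fun k _ => ?_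
  rw [← mul_assoc, ← ENNReal.ofReal_mul hs.le, normWeights, mul_div_cancel₀ _ hs.ne']

theorem ofReal_propDensity_mul (hδ : ∀ t, 0 < δ t) (t : Fin T) (x y u : State D) :
    ENNReal.ofReal (F.propDensity δ t x u y) * ENNReal.ofReal (F.potential κ δ t x y u) =
      ENNReal.ofReal (F.auxQ κ δ t x y u) :=
  (ENNReal.ofReal_mul (F.propDensity_pos δ hδ t x u y).le).symm

theorem ofReal_auxQ (hδ : ∀ t, 0 < δ t) (t : Fin T) (x y u : State D) :
    ENNReal.ofReal (F.auxQ κ δ t x y u) = ENNReal.ofReal (F.Q t x y) *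
      ENNReal.ofReal (gaussDensity (F.auxMean κ δ t x y) (Model.auxCov δ t) u) := by
  rw [F.auxQ_eq κ δ hδ, ENNReal.ofReal_mul (F.Q_pos t x y).le]

theorem lintegral_propLaw (hδ : ∀ t, 0 < δ t) (t : Fin T) (x u : State D) {g : State D → ENNReal}
    (hg : Measurable g) : ∫⁻ y, g y ∂F.propLaw δ t x u =
      ∫⁻ y, ENNReal.ofReal (F.propDensity δ t x u y) * g y := by
  rw [F.propLaw_eq_withDensity δ hδ, lintegral_withDensity_eq_lintegral_mul _ (by fun_prop) hg]
  rfl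

/-- In Q' = M' G' the factor M' supplies the law of the overwritten coordinate and G' remains as its
weight; `lintegral_pi_update` then removes the overwriting. -/
theorem lintegral_auxQ_update (hδ : ∀ t, 0 < δ t) (t : Fin T) (s : Slot D N)
    (a : Fin (N + 1) → Fin (N + 1)) (k : Fin (N + 1)) (u : State D)
    {Φ : (Fin (N + 1) → State D) → ENNReal} (hΦ : Measurable Φ) :
    ∫⁻ y, ENNReal.ofReal (F.auxQ κ δ t (Slot.particle s (a k)) y u) *
        ∫⁻ z, proposalDensity F δ t s a u z * Φ (Function.update z k y) =
      ∫⁻ z, proposalDensity F δ t s a u z *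
        (ENNReal.ofReal (F.potential κ δ t (Slot.particle s (a k)) (z k) u) * Φ z) := by
  set g : (Fin (N + 1) → State D) → ENNReal := fun z =>
    ENNReal.ofReal (F.potential κ δ t (Slot.particle s (a k)) (z k) u) * Φ z with hgdef
  have hg : Measurable g := Measurable.mul (by fun_prop) hΦ
  have hgu : Measurable fun y => ∫⁻ z, g (Function.update z k y)
      ∂Measure.pi (fun n => F.propLaw δ t (Slot.particle s (a n)) u) := by
    refine Measurable.lintegral_prod_right ?_
    simp only [Function.uncurry_def]
    exact hg.comp (measurable_update_apply k measurable_snd measurable_fst)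
  have h1 := lintegral_pi_update (fun n => F.propLaw δ t (Slot.particle s (a n)) u) k hg
  rw [lintegral_propLaw F δ hδ t _ u hgu, lintegral_pi_propLaw F δ hδ t s a u hg] at h1
  rw [← h1]
  refine lintegral_congr fun y => ?_
  have hΦu : Measurable fun z => Φ (Function.update z k y) :=
    hΦ.comp (measurable_update_apply k measurable_id measurable_const)
  rw [← ofReal_propDensity_mul F κ δ hδ, mul_assoc]
  simp only [hgdef, Function.update_self]
  rw [lintegral_const_mul _ hΦu, lintegral_pi_propLaw F δ hδ t s a u hΦu]

/-- The reference particle, moved according to the model, has the law of the other particles up to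
its weight. -/
theorem lintegral_reference (hδ : ∀ t, 0 < δ t) (t : Fin T) (s : Slot D N)
    (a : Fin (N + 1) → Fin (N + 1)) (k : Fin (N + 1))
    {Φ : State D → (Fin (N + 1) → State D) → ENNReal} (hΦ : Measurable (Function.uncurry Φ)) :
    ∫⁻ y, ENNReal.ofReal (F.Q t (Slot.particle s (a k)) y) *
        ∫⁻ u, ENNReal.ofReal (gaussDensity (F.auxMean κ δ t (Slot.particle s (a k)) y)
            (Model.auxCov δ t) u) *
          ∫⁻ z, proposalDensity F δ t s a u z * Φ u (Function.update z k y) =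
      ∫⁻ u, ∫⁻ z, proposalDensity F δ t s a u z *
        (ENNReal.ofReal (F.potential κ δ t (Slot.particle s (a k)) (z k) u) * Φ u z) := by
  set p := Slot.particle s (a k) with hp
  have hI : Measurable fun q : State D × State D =>
      ∫⁻ z, proposalDensity F δ t s a q.2 z * Φ q.2 (Function.update z k q.1) := by
    refine Measurable.lintegral_prod_right ?_
    simp only [Function.uncurry_def]
    have hu : Measurable fun r : (State D × State D) × (Fin (N + 1) → State D) =>
        Function.update r.2 k r.1.1 :=
      measurable_update_apply k measurable_snd (measurable_fst.comp measurable_fst)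
    exact Measurable.mul (by fun_prop) (hΦ.comp ((measurable_snd.comp measurable_fst).prodMk hu))
  have hIy : ∀ y, Measurable fun u =>
      ∫⁻ z, proposalDensity F δ t s a u z * Φ u (Function.update z k y) :=
    fun y => by
      have h := hI.comp (measurable_prodMk_left (x := y))
      exact h
  calc _ = ∫⁻ y, ∫⁻ u, ENNReal.ofReal (F.auxQ κ δ t p y u) *
          ∫⁻ z, proposalDensity F δ t s a u z * Φ u (Function.update z k y) := by
        refine lintegral_congr fun y => ?_
        have hm : Measurable fun u =>
            ENNReal.ofReal (gaussDensity (F.auxMean κ δ t p y) (Model.auxCov δ t) u) *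
              ∫⁻ z, proposalDensity F δ t s a u z * Φ u (Function.update z k y) :=
          Measurable.mul (by fun_prop) (hIy y)
        rw [← lintegral_const_mul _ hm]
        refine lintegral_congr fun u => ?_
        rw [ofReal_auxQ F κ δ hδ, mul_assoc]
    _ = ∫⁻ u, ∫⁻ y, ENNReal.ofReal (F.auxQ κ δ t p y u) *
          ∫⁻ z, proposalDensity F δ t s a u z * Φ u (Function.update z k y) :=
        lintegral_lintegral_swap (Measurable.mul (by fun_prop) hI).aemeasurable
    _ = _ := by
        exact lintegral_congr fun u => lintegral_auxQ_update F κ δ hδ t s a k u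
          (hΦ.of_uncurry_left (x := u))

theorem measurable_slot_mk (t : Fin T) (s : Slot D N) (a : Fin (N + 1) → Fin (N + 1))
    (k : Fin (N + 1)) : Measurable fun p : State D × (Fin (N + 1) → State D) =>
      ((p.1, p.2, normWeights F κ δ t s a p.1 p.2, k) : Slot D N) := by
  fun_prop

/-- One step of the algorithm, with a reference path from the model whose previous state is drawn
according to the weights, is one step of the particle system followed by a draw of the new
reference index according to the weights. -/
theorem sum_lintegral_stepIntegral (hδ : ∀ t, 0 < δ t) (t : Fin T) {s : Slot D N}
    (hs : ∀ n, 0 ≤ Slot.weight s n) {h : Fin (N + 1) → Slot D N → ENNReal}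
    (hh : ∀ k, Measurable (h k)) :
    ∑ k₀, ENNReal.ofReal (Slot.weight s k₀) *
        ∫⁻ y, ENNReal.ofReal (F.Q t (Slot.particle s k₀) y) *
          stepIntegral F κ δ t s k₀ (Slot.particle s k₀) y
            (fun s' => h (Slot.ref s') (Slot.erase s')) =
      systemStep F κ δ t s fun s' => ∑ k, ENNReal.ofReal (Slot.weight s' k) * h k s' := by
  set w : Fin (N + 1) → ENNReal := fun n => ENNReal.ofReal (Slot.weight s n) with hw
  set Φ : Fin (N + 1) → (Fin (N + 1) → Fin (N + 1)) → State D → (Fin (N + 1) → State D) →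
    ENNReal := fun k a u z => h k (u, z, normWeights F κ δ t s a u z, 0) with hΦ
  have hΦm : ∀ k a, Measurable (Function.uncurry (Φ k a)) := fun k a =>
    (hh k).comp (measurable_slot_mk F κ δ t s a 0)
  set J : Fin (N + 1) → Fin (N + 1) → (Fin (N + 1) → Fin (N + 1)) → State D → ENNReal :=
    fun k₀ k a y => ∫⁻ u, ENNReal.ofReal (gaussDensity (F.auxMean κ δ t (Slot.particle s k₀) y)
            (Model.auxCov δ t) u) *
          ∫⁻ z, proposalDensity F δ t s a u z * Φ k a u (Function.update z k y) with hJ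
  have hJm : ∀ k₀ k a, Measurable (J k₀ k a) := by
    intro k₀ k a
    refine Measurable.lintegral_prod_right ?_
    simp only [Function.uncurry_def]
    refine Measurable.mul (by fun_prop) (Measurable.lintegral_prod_right ?_)
    simp only [Function.uncurry_def]
    have hu : Measurable fun r : (State D × State D) × (Fin (N + 1) → State D) =>
        Function.update r.2 k r.1.1 :=
      measurable_update_apply k measurable_snd (measurable_fst.comp measurable_fst)
    exact Measurable.mul (by fun_prop)
      ((hΦm k a).comp ((measurable_snd.comp measurable_fst).prodMk hu))
  set I : Fin (N + 1) → Fin (N + 1) → (Fin (N + 1) → Fin (N + 1)) → ENNReal := fun k₀ k a =>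
    ∫⁻ y, ENNReal.ofReal (F.Q t (Slot.particle s k₀) y) * J k₀ k a y with hI
  have hleft : ∀ k₀, ∫⁻ y, ENNReal.ofReal (F.Q t (Slot.particle s k₀) y) *
        stepIntegral F κ δ t s k₀ (Slot.particle s k₀) y
          (fun s' => h (Slot.ref s') (Slot.erase s')) =
      ∑ k, ((N : ENNReal) + 1)⁻¹ * ∑ a, ENNReal.ofReal (parentProb (Slot.weight s) k₀ k a) *
        I k₀ k a := by
    intro k₀
    have hQ : Measurable fun y => ENNReal.ofReal (F.Q t (Slot.particle s k₀) y) := by fun_prop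
    have hint : ∀ y, ENNReal.ofReal (F.Q t (Slot.particle s k₀) y) *
          stepIntegral F κ δ t s k₀ (Slot.particle s k₀) y
          (fun s' => h (Slot.ref s') (Slot.erase s')) =
        ∑ k, ((N : ENNReal) + 1)⁻¹ * ∑ a, ENNReal.ofReal (parentProb (Slot.weight s) k₀ k a) *
          (ENNReal.ofReal (F.Q t (Slot.particle s k₀) y) * J k₀ k a y) := by
      intro y
      unfold stepIntegral
      rw [Finset.mul_sum]
      refine Finset.sum_congr rfl fun k _ => ?_
      rw [mul_left_comm, Finset.mul_sum]
      congr 1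
      exact Finset.sum_congr rfl fun a _ => mul_left_comm _ _ _
    have hm : ∀ k a, Measurable fun y =>
        ENNReal.ofReal (F.Q t (Slot.particle s k₀) y) * J k₀ k a y := fun k a => hQ.mul (hJm k₀ k a)
    simp_rw [hint]
    rw [lintegral_finsetSum _ fun k _ => Measurable.const_mul
      (Finset.measurable_sum _ fun a _ => (hm k a).const_mul _) _]
    refine Finset.sum_congr rfl fun k _ => ?_
    rw [lintegral_const_mul _ (Finset.measurable_sum _ fun a _ => (hm k a).const_mul _),
      lintegral_finsetSum _ fun a _ => (hm k a).const_mul _]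
    congr 1
    exact Finset.sum_congr rfl fun a _ => lintegral_const_mul _ (hm k a)
  -- The weight of the old reference index k₀ is the missing resampling factor of the particle k,
  -- whose ancestor is forced to be k₀. The product is that of independent resampling for all
  -- particles.
  have hpar : ∀ k₀ k (a : Fin (N + 1) → Fin (N + 1)),
      w k₀ * ENNReal.ofReal (parentProb (Slot.weight s) k₀ k a) =
        if a k = k₀ then ∏ n, w (a n) else 0 := by
    intro k₀ k a
    unfold parentProb
    rw [ENNReal.ofReal_prod_of_nonneg fun n _ => by
      split_ifs
      exacts [zero_le_one, le_rfl, hs _], ← Finset.mul_prod_erase _ _ (Finset.mem_univ k)]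
    rw [if_pos rfl]
    split_ifs with hk
    · rw [← Finset.mul_prod_erase Finset.univ (fun n => w (a n)) (Finset.mem_univ k), hk,
        ENNReal.ofReal_one, one_mul]
      congr 1
      exact Finset.prod_congr rfl fun n hn => by rw [if_neg (Finset.ne_of_mem_erase hn)]
    · simp
  -- Summing over k₀ leaves only k₀ = a k, so the old reference index survives solely as an
  -- ancestor.
  have hsum : ∀ k, ∑ k₀, ∑ a, w k₀ * (ENNReal.ofReal (parentProb (Slot.weight s) k₀ k a) *
      I k₀ k a) = ∑ a, (∏ n, w (a n)) * I (a k) k a := by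
    intro k
    rw [Finset.sum_comm]
    refine Finset.sum_congr rfl fun a _ => ?_
    simp_rw [← mul_assoc, hpar, ite_mul, zero_mul]
    rw [Finset.sum_ite_eq Finset.univ (a k)]
    simp
  have hIeq : ∀ k a, I (a k) k a = ∫⁻ u, ∫⁻ z, proposalDensity F δ t s a u z *
        (ENNReal.ofReal (F.potential κ δ t (Slot.particle s (a k)) (z k) u) * Φ k a u z) :=
    fun k a => lintegral_reference F κ δ hδ t s a k (hΦm k a)
  have hm2 : ∀ k (a : Fin (N + 1) → Fin (N + 1)),
      Measurable fun p : State D × (Fin (N + 1) → State D) => proposalDensity F δ t s a p.1 p.2 *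
        (ENNReal.ofReal (F.potential κ δ t (Slot.particle s (a k)) (p.2 k) p.1) *
          Φ k a p.1 p.2) :=
    fun k a => Measurable.mul (by fun_prop) (Measurable.mul (by fun_prop) (hΦm k a))
  have hm3 : ∀ u k (a : Fin (N + 1) → Fin (N + 1)),
      Measurable fun z : Fin (N + 1) → State D => proposalDensity F δ t s a u z *
        (ENNReal.ofReal (F.potential κ δ t (Slot.particle s (a k)) (z k) u) * Φ k a u z) :=
    fun u k a => by
      have h := (hm2 k a).comp (measurable_prodMk_left (x := u))
      exact h
  calc _ = ((N : ENNReal) + 1)⁻¹ * ∑ k, ∑ k₀, ∑ a, w k₀ *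
        (ENNReal.ofReal (parentProb (Slot.weight s) k₀ k a) * I k₀ k a) := by
        simp_rw [hleft, Finset.mul_sum]
        rw [Finset.sum_comm]
        refine Finset.sum_congr rfl fun k _ => Finset.sum_congr rfl fun k₀ _ =>
          Finset.sum_congr rfl fun a _ => mul_left_comm _ _ _
    _ = _ := by
        simp_rw [hsum]
        unfold systemStep
        rw [Finset.sum_comm]
        congr 1
        refine Finset.sum_congr rfl fun a _ => ?_
        rw [← Finset.mul_sum]
        congr 1
        simp_rw [hIeq]
        rw [← lintegral_finsetSum _ fun k _ => Measurable.lintegral_prod_right (hm2 k a)]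
        refine lintegral_congr fun u => ?_
        rw [← lintegral_finsetSum _ fun k _ => hm3 u k a]
        refine lintegral_congr fun z => ?_
        rw [← Finset.mul_sum]
        congr 1
        exact (sum_potential_mul_normWeights F κ δ hδ t s a u z fun k => Φ k a u z).symm

@[fun_prop]
theorem measurable_backwardProb {α : Type*} [MeasurableSpace α] (t : Fin T) {s s' : α → Slot D N}
    (hs : Measurable s) (hs' : Measurable s') (j i : Fin (N + 1)) :
    Measurable fun b => backwardProb F κ δ t (s b) (s' b) j i := by
  unfold backwardProb
  exact Measurable.div (by fun_prop) (Finset.measurable_sum _ fun n _ => by fun_prop)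

theorem backward_denominator_pos (hδ : ∀ t, 0 < δ t) (t : Fin T) {s : Slot D N}
    (hs : (∀ n, 0 ≤ Slot.weight s n) ∧ ∑ n, Slot.weight s n = 1) (y u : State D) :
    0 < ∑ n, Slot.weight s n * F.auxQ κ δ t (Slot.particle s n) y u := by
  have hq := fun n => F.auxQ_pos κ δ hδ t (Slot.particle s n) y u
  obtain ⟨n, -, hn⟩ : ∃ n ∈ Finset.univ, Slot.weight s n ≠ 0 :=
    Finset.exists_ne_zero_of_sum_ne_zero (by rw [hs.2]; exact one_ne_zero)
  exact Finset.sum_pos' (fun n _ => mul_nonneg (hs.1 n) (hq n).le)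
    ⟨n, Finset.mem_univ n, mul_pos ((hs.1 n).lt_of_ne' hn) (hq n)⟩

theorem backwardProb_nonneg (hδ : ∀ t, 0 < δ t) (t : Fin T) {s : Slot D N}
    (hs : (∀ n, 0 ≤ Slot.weight s n) ∧ ∑ n, Slot.weight s n = 1) (s' : Slot D N)
    (j i : Fin (N + 1)) : 0 ≤ backwardProb F κ δ t s s' j i :=
  div_nonneg (mul_nonneg (hs.1 i) (F.auxQ_pos κ δ hδ t _ _ _).le)
    (backward_denominator_pos F κ δ hδ t hs _ _).le

theorem sum_backwardProb (hδ : ∀ t, 0 < δ t) (t : Fin T) {s : Slot D N}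
    (hs : (∀ n, 0 ≤ Slot.weight s n) ∧ ∑ n, Slot.weight s n = 1) (s' : Slot D N)
    (j : Fin (N + 1)) : ∑ i, ENNReal.ofReal (backwardProb F κ δ t s s' j i) = 1 := by
  rw [← ENNReal.ofReal_sum_of_nonneg fun i _ => backwardProb_nonneg F κ δ hδ t hs s' j i]
  simp only [backwardProb, ← Finset.sum_div]
  rw [div_self (backward_denominator_pos F κ δ hδ t hs _ _).ne', ENNReal.ofReal_one]

theorem measurePreserving_eval_propLaw (t : Fin T) (s : Slot D N)
    (a : Fin (N + 1) → Fin (N + 1)) (u : State D) (j : Fin (N + 1)) :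
    MeasurePreserving (Function.eval j)
      (Measure.pi fun n => F.propLaw δ t (Slot.particle s (a n)) u)
      (F.propLaw δ t (Slot.particle s (a j)) u) :=
  measurePreserving_eval _ j

/-- The reweighted integral of a function of a single particle. -/
theorem lintegral_proposalDensity_potential (hδ : ∀ t, 0 < δ t) (t : Fin T) (s : Slot D N)
    (a : Fin (N + 1) → Fin (N + 1)) (u : State D) (j : Fin (N + 1)) {φ : State D → ENNReal}
    (hφ : Measurable φ) :
    ∫⁻ z, proposalDensity F δ t s a u z *
        (ENNReal.ofReal (F.potential κ δ t (Slot.particle s (a j)) (z j) u) * φ (z j)) =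
      ∫⁻ y, ENNReal.ofReal (F.auxQ κ δ t (Slot.particle s (a j)) y u) * φ y := by
  have hg : Measurable fun y =>
      ENNReal.ofReal (F.potential κ δ t (Slot.particle s (a j)) y u) * φ y :=
    Measurable.mul (by fun_prop) hφ
  have h1 := (measurePreserving_eval_propLaw F δ t s a u j).lintegral_comp hg
  rw [lintegral_propLaw F δ hδ t _ u hg] at h1
  simp only [Function.eval] at h1
  have hge : Measurable fun z : Fin (N + 1) → State D =>
      ENNReal.ofReal (F.potential κ δ t (Slot.particle s (a j)) (z j) u) * φ (z j) :=
    hg.comp (measurable_pi_apply j)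
  rw [lintegral_pi_propLaw F δ hδ t s a u hge] at h1
  rw [h1]
  refine lintegral_congr fun y => ?_
  rw [← ofReal_propDensity_mul F κ δ hδ, mul_assoc]

/-- Integrating the auxiliary variable out. -/
theorem lintegral_auxQ (hδ : ∀ t, 0 < δ t) (t : Fin T) (x : State D) {φ : State D → ENNReal}
    (hφ : Measurable φ) :
    ∫⁻ u, ∫⁻ y, ENNReal.ofReal (F.auxQ κ δ t x y u) * φ y =
      ∫⁻ y, ENNReal.ofReal (F.Q t x y) * φ y := by
  have hm : Measurable fun p : State D × State D =>
      ENNReal.ofReal (F.auxQ κ δ t x p.2 p.1) * φ p.2 :=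
    Measurable.mul (by fun_prop) (hφ.comp measurable_snd)
  rw [lintegral_lintegral_swap hm.aemeasurable]
  refine lintegral_congr fun y => ?_
  simp only [ofReal_auxQ F κ δ hδ]
  rw [lintegral_mul_const _ (by fun_prop), lintegral_const_mul _ (by fun_prop),
    lintegral_gaussDensity _ (Model.auxCov_posDef δ hδ t), mul_one]

/-- One step of the particle system followed by a draw of an index according to the weights and by
one step of backward sampling amounts to a draw of an index according to the previous weights and
a transition of the model. -/
theorem systemStep_backward (hδ : ∀ t, 0 < δ t) (t : Fin T) {s : Slot D N}
    (hs : (∀ n, 0 ≤ Slot.weight s n) ∧ ∑ n, Slot.weight s n = 1)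
    {b : Fin (N + 1) → State D → ENNReal} (hb : ∀ i, Measurable (b i)) :
    (systemStep F κ δ t s fun s' => ∑ j, ENNReal.ofReal (Slot.weight s' j) *
        ∑ i, ENNReal.ofReal (backwardProb F κ δ t s s' j i) * b i (Slot.particle s' j)) =
      ∑ i, ENNReal.ofReal (Slot.weight s i) *
        ∫⁻ y, ENNReal.ofReal (F.Q t (Slot.particle s i) y) * b i y := by
  set w : Fin (N + 1) → ENNReal := fun n => ENNReal.ofReal (Slot.weight s n) with hw
  have hw1 : ∑ n, w n = 1 := by
    rw [hw, ← ENNReal.ofReal_sum_of_nonneg fun n _ => hs.1 n, hs.2, ENNReal.ofReal_one]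
  set q : Fin (N + 1) → State D → State D → ENNReal := fun n y u =>
    ENNReal.ofReal (F.auxQ κ δ t (Slot.particle s n) y u) with hq
  -- The backward average for a selected particle at y. It depends on y and u alone, not on the
  -- ancestors or the other particles.
  set Ξ : State D → State D → ENNReal := fun u y =>
    ∑ i, ENNReal.ofReal (Slot.weight s i * F.auxQ κ δ t (Slot.particle s i) y u /
      ∑ n, Slot.weight s n * F.auxQ κ δ t (Slot.particle s n) y u) * b i y with hΞ
  have hΞm : Measurable (Function.uncurry Ξ) := by
    refine Finset.measurable_sum _ fun i _ => Measurable.mul (Measurable.ennreal_ofReal ?_)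
      ((hb i).comp measurable_snd)
    exact Measurable.div (by fun_prop) (Finset.measurable_sum _ fun n _ => by fun_prop)
  have hqm : ∀ n, Measurable fun p : State D × State D => q n p.2 p.1 := fun n => by
    simp only [hq]
    fun_prop
  set V : Fin (N + 1) → ENNReal := fun n => ∫⁻ u, ∫⁻ y, q n y u * Ξ u y with hV
  have hVm : ∀ n, Measurable fun p : State D × State D => q n p.2 p.1 * Ξ p.1 p.2 :=
    fun n => (hqm n).mul hΞm
  have hVm' : ∀ n u, Measurable fun y => q n y u * Ξ u y := fun n u => by
    have h := (hVm n).comp (measurable_prodMk_left (x := u))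
    exact h
  have hVI : ∀ n, Measurable fun u => ∫⁻ y, q n y u * Ξ u y := fun n =>
    Measurable.lintegral_prod_right (hVm n)
  have hinner : ∀ a : Fin (N + 1) → Fin (N + 1), (∫⁻ u, ∫⁻ z, proposalDensity F δ t s a u z *
        (ENNReal.ofReal (∑ j, F.potential κ δ t (Slot.particle s (a j)) (z j) u) *
          ∑ j, ENNReal.ofReal (normWeights F κ δ t s a u z j) * Ξ u (z j))) = ∑ j, V (a j) := by
    intro a
    rw [← lintegral_finsetSum _ fun j _ => Measurable.lintegral_prod_right (hVm (a j))]
    refine lintegral_congr fun u => ?_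
    have hΞu : Measurable (Ξ u) := hΞm.of_uncurry_left
    have hjm : ∀ j, Measurable fun z : Fin (N + 1) → State D => proposalDensity F δ t s a u z *
        (ENNReal.ofReal (F.potential κ δ t (Slot.particle s (a j)) (z j) u) * Ξ u (z j)) :=
      fun j => Measurable.mul (by fun_prop) (Measurable.mul (by fun_prop)
        (hΞu.comp (measurable_pi_apply j)))
    simp_rw [sum_potential_mul_normWeights F κ δ hδ, Finset.mul_sum]
    rw [lintegral_finsetSum _ fun j _ => hjm j]
    exact Finset.sum_congr rfl fun j _ =>
      lintegral_proposalDensity_potential F κ δ hδ t s a u j hΞu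
  -- Averaging over the actual ancestor n produces the mixture that is the denominator in Ξ, so the
  -- two cancel.
  have hmix : ∀ u y, ∑ n, w n * (q n y u * Ξ u y) = ∑ i, w i * (q i y u * b i y) := by
    intro u y
    have hd := backward_denominator_pos F κ δ hδ t hs y u
    have hwq : ∀ n, w n * q n y u =
        ENNReal.ofReal (Slot.weight s n * F.auxQ κ δ t (Slot.particle s n) y u) := fun n =>
      (ENNReal.ofReal_mul (hs.1 n)).symm
    simp_rw [← mul_assoc, hwq, ← Finset.sum_mul]
    rw [← ENNReal.ofReal_sum_of_nonneg fun n _ =>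
      mul_nonneg (hs.1 n) (F.auxQ_pos κ δ hδ t _ y u).le, hΞ]
    simp only [Finset.mul_sum]
    refine Finset.sum_congr rfl fun i _ => ?_
    rw [← mul_assoc, ← ENNReal.ofReal_mul hd.le, mul_div_cancel₀ _ hd.ne']
  have hbm : ∀ i, Measurable fun p : State D × State D => q i p.2 p.1 * b i p.2 :=
    fun i => (hqm i).mul ((hb i).comp measurable_snd)
  have hbm' : ∀ i u, Measurable fun y => q i y u * b i y := fun i u => by
    have h := (hbm i).comp (measurable_prodMk_left (x := u))
    exact h
  have hbI : ∀ i, Measurable fun u => ∫⁻ y, q i y u * b i y := fun i =>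
    Measurable.lintegral_prod_right (hbm i)
  calc _ = ((N : ENNReal) + 1)⁻¹ * ∑ a : Fin (N + 1) → Fin (N + 1), (∏ n, w (a n)) *
        ∑ j, V (a j) := by
        unfold systemStep
        congr 1
        refine Finset.sum_congr rfl fun a _ => ?_
        rw [← hinner a]
        rfl
    -- Each of the N + 1 particles contributes the same amount, since its ancestor has marginal law
    -- w; this uses up the factor 1/(N + 1).
    _ = ∑ n, w n * V n := by
        have h : ∀ a : Fin (N + 1) → Fin (N + 1), (∏ n, w (a n)) * ∑ j, V (a j) =
            ∑ j, (∏ n, w (a n)) * V (a j) := fun a => Finset.mul_sum _ _ _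
        simp_rw [h]
        rw [Finset.sum_comm]
        simp_rw [sum_prod_mul_apply hw1]
        rw [Finset.mul_sum, ← Finset.sum_mul, inv_mul_sum_one, one_mul]
    _ = ∫⁻ u, ∫⁻ y, ∑ n, w n * (q n y u * Ξ u y) := by
        refine (Finset.sum_congr rfl fun n _ => (lintegral_const_mul (w n) (hVI n)).symm).trans ?_
        rw [← lintegral_finsetSum _ fun n _ => (hVI n).const_mul _]
        refine lintegral_congr fun u => ?_
        rw [lintegral_finsetSum _ fun n _ => (hVm' n u).const_mul _]
        exact Finset.sum_congr rfl fun n _ => (lintegral_const_mul _ (hVm' n u)).symm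
    _ = ∫⁻ u, ∫⁻ y, ∑ i, w i * (q i y u * b i y) := by simp_rw [hmix]
    _ = ∑ i, w i * ∫⁻ u, ∫⁻ y, q i y u * b i y := by
        refine Eq.trans ?_ (Finset.sum_congr rfl fun i _ => lintegral_const_mul (w i) (hbI i))
        rw [← lintegral_finsetSum _ fun n _ => (hbI n).const_mul _]
        refine lintegral_congr fun u => ?_
        rw [lintegral_finsetSum _ fun n _ => (hbm' n u).const_mul _]
        exact Finset.sum_congr rfl fun n _ => lintegral_const_mul _ (hbm' n u)
    _ = _ := Finset.sum_congr rfl fun i _ =>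
        congrArg _ (lintegral_auxQ F κ δ hδ t (Slot.particle s i) (hb i))

end ParticleSystem

/-! ### Paths built one state at a time, and their partial densities -/

section Paths

variable {D T : ℕ}

theorem lintegral_snoc {E : Type*} [MeasureSpace E] [SigmaFinite (volume : Measure E)] {t : ℕ}
    {f : (Fin (t + 1) → E) → ENNReal} (hf : Measurable f) :
    ∫⁻ x, f x = ∫⁻ x : Fin t → E, ∫⁻ y, f (Fin.snoc (α := fun _ => E) x y) := by
  have h := (volume_preserving_piFinSuccAbove (fun _ : Fin (t + 1) => E) (Fin.last t)).symm
  rw [← h.lintegral_comp hf]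
  have hm : Measurable fun p : E × (Fin t → E) => f (Fin.snoc (α := fun _ => E) p.2 p.1) :=
    hf.comp (measurable_snoc measurable_snd measurable_fst)
  have he : ∀ p : E × (Fin t → E),
      (MeasurableEquiv.piFinSuccAbove (fun _ : Fin (t + 1) => E) (Fin.last t)).symm p =
        Fin.snoc (α := fun _ => E) p.2 p.1 := fun p => by
    simp [MeasurableEquiv.piFinSuccAbove_symm_apply, Fin.insertNthEquiv, Fin.insertNth_last']
  simp_rw [he]
  exact lintegral_prod_symm _ hm.aemeasurable

/-- The last state of a path, or the dummy value `0` if the path is empty. -/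
def lastState : {t : ℕ} → (Fin t → State D) → State D
  | 0, _ => 0
  | t + 1, x => x (Fin.last t)

@[fun_prop]
theorem measurable_lastState {α : Type*} [MeasurableSpace α] {t : ℕ} {x : α → Fin t → State D}
    (hx : Measurable x) : Measurable fun a => lastState (x a) := by
  cases t with
  | zero => exact measurable_const
  | succ t => exact (measurable_pi_apply (Fin.last t)).comp hx

/-- Extension of a path by the dummy value `0`. -/
def extendPath {t : ℕ} (x : Fin t → State D) : Path D T :=
  fun i => if h : i.val < t then x ⟨i, h⟩ else 0

theorem measurable_extendPath {t : ℕ} :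
    Measurable (extendPath : (Fin t → State D) → Path D T) := by
  refine measurable_pi_iff.2 fun i => ?_
  unfold extendPath
  split_ifs <;> fun_prop

theorem extendPath_self (x : Path D T) : (extendPath x : Path D T) = x := by
  funext i
  simp [extendPath]

theorem extendPath_snoc_lt {t : ℕ} (x : Fin t → State D) (y : State D) (i : Fin T)
    (hi : i.val < t) :
    (extendPath (Fin.snoc (α := fun _ => State D) x y) : Path D T) i = extendPath x i := by
  simp [extendPath, hi, Nat.lt_succ_of_lt hi, Fin.snoc]

theorem extendPath_snoc_last {t : ℕ} (ht : t < T) (x : Fin t → State D) (y : State D) :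
    (extendPath (Fin.snoc (α := fun _ => State D) x y) : Path D T) ⟨t, ht⟩ = y := by
  simp [extendPath, Fin.snoc]

theorem pred_extendPath {t : ℕ} (ht : t < T) (x : Fin t → State D) (y : State D) :
    pred (extendPath (Fin.snoc (α := fun _ => State D) x y) : Path D T) ⟨t, ht⟩ = lastState x := by
  cases t with
  | zero => simp [pred, lastState]
  | succ t => simp [pred, lastState, extendPath, Fin.snoc, Fin.last]

theorem pred_snoc_castSucc {t : ℕ} (x : Fin t → State D) (y : State D) (i : Fin t) :
    pred (Fin.snoc (α := fun _ => State D) x y : Path D (t + 1)) i.castSucc = pred x i := by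
  unfold pred
  have hi := i.isLt
  simp only [Fin.val_castSucc]
  split_ifs with h
  · have h1 : i.val - 1 < t := by omega
    simp [Fin.snoc, h1]
  · rfl

theorem pred_snoc_last {t : ℕ} (x : Fin t → State D) (y : State D) :
    pred (Fin.snoc (α := fun _ => State D) x y : Path D (t + 1)) (Fin.last t) = lastState x := by
  cases t with
  | zero => simp [pred, lastState]
  | succ t => simp [pred, lastState, Fin.snoc, Fin.last]

variable (F : Model D T)

/-- The unnormalised density of the first `t` states. -/
def partialDensity (t : ℕ) (ht : t ≤ T) (x : Fin t → State D) : ENNReal :=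
  ∏ i : Fin t, ENNReal.ofReal (F.Q (Fin.castLE ht i) (pred x i) (x i))

theorem partialDensity_snoc (t : ℕ) (ht : t + 1 ≤ T) (x : Fin t → State D) (y : State D) :
    partialDensity F (t + 1) ht (Fin.snoc (α := fun _ => State D) x y) =
      partialDensity F t (Nat.le_of_succ_le ht) x *
        ENNReal.ofReal (F.Q ⟨t, ht⟩ (lastState x) y) := by
  unfold partialDensity
  rw [Fin.prod_univ_castSucc, pred_snoc_last]
  congr 1
  · exact Finset.prod_congr rfl fun i _ => by
      rw [pred_snoc_castSucc, Fin.snoc_castSucc]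
      rfl
  · rw [Fin.snoc_last]
    rfl

theorem partialDensity_self (x : Path D T) :
    partialDensity F T le_rfl x = ENNReal.ofReal (F.pathDensity x) := by
  unfold partialDensity Model.pathDensity
  rw [ENNReal.ofReal_prod_of_nonneg fun i _ => (F.Q_pos _ _ _).le]
  rfl

@[fun_prop]
theorem measurable_partialDensity (t : ℕ) (ht : t ≤ T) : Measurable (partialDensity F t ht) :=
  Finset.measurable_prod _ fun i _ => by fun_prop

end Paths

/-! ### Inductions over time: the forward identity and the backward identity -/

section Invariance

variable {D T N : ℕ} (F : Model D T) (κ : ℝ) (δ : Fin T → ℝ)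

/-- The integral over the first `t` records in the particle system without a reference path, with
all steps reweighted as in `systemStep`. -/
def systemIntegral : (t : ℕ) → t ≤ T → ((Fin t → Slot D N) → ENNReal) → ENNReal
  | 0, _, g => g fun i => i.elim0
  | t + 1, ht, g => systemIntegral t (Nat.le_of_succ_le ht) fun H =>
      systemStep F κ δ ⟨t, ht⟩ (Slot.lastOrOrigin H) fun s =>
        g (Fin.snoc (α := fun _ => Slot D N) H s)

/-- `systemIntegral` is a functional and not a measure, so almost sure equality is replaced by
equality at histories with a normalised last record; no measurability is needed. -/
theorem systemIntegral_succ_congr (hδ : ∀ t, 0 < δ t) (t : ℕ) (ht : t + 1 ≤ T)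
    {g g' : (Fin (t + 1) → Slot D N) → ENNReal}
    (hg : ∀ H, Slot.IsNormalized (H (Fin.last t)) → g H = g' H) :
    systemIntegral F κ δ (t + 1) ht g = systemIntegral F κ δ (t + 1) ht g' := by
  unfold systemIntegral
  congr 1
  funext H
  exact systemStep_congr F κ δ hδ _ _ fun s hs => hg _ (by rwa [Fin.snoc_last])

theorem systemIntegral_congr (hδ : ∀ t, 0 < δ t) (t : ℕ) (ht : t ≤ T)
    {g g' : (Fin t → Slot D N) → ENNReal}
    (hg : ∀ H, ((∀ n, 0 ≤ Slot.weight (Slot.lastOrOrigin H) n) ∧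
      ∑ n, Slot.weight (Slot.lastOrOrigin H) n = 1) → g H = g' H) :
    systemIntegral F κ δ t ht g = systemIntegral F κ δ t ht g' := by
  cases t with
  | zero => exact hg _ (Slot.weight_lastOrOrigin fun i => i.elim0)
  | succ t =>
    exact systemIntegral_succ_congr F κ δ hδ t ht fun H hH => hg H ⟨fun n => (hH.1 n).le, hH.2⟩

theorem lastOrOrigin_erase {t : ℕ} (H : Fin t → Slot D N) :
    Slot.lastOrOrigin (fun i => Slot.erase (H i)) = Slot.erase (Slot.lastOrOrigin H) := by
  cases t <;> rfl

theorem lastOrOrigin_snoc {t : ℕ} (H : Fin t → Slot D N) (s : Slot D N) :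
    Slot.lastOrOrigin (Fin.snoc (α := fun _ => Slot D N) H s) = s :=
  Fin.snoc_last (α := fun _ => Slot D N) s H

theorem erase_snoc {t : ℕ} (H : Fin t → Slot D N) (s : Slot D N) :
    (fun i => Slot.erase (Fin.snoc (α := fun _ => Slot D N) H s i)) =
      Fin.snoc (α := fun _ => Slot D N) (fun i => Slot.erase (H i)) (Slot.erase s) := by
  funext i
  induction i using Fin.lastCases <;> simp

theorem IsAdmissible.particle_lastOrOrigin {t : ℕ} (ht : t ≤ T) {x : Fin t → State D}
    {H : Fin t → Slot D N} (hH : IsAdmissible (extendPath x : Path D T) ht H) :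
    Slot.particle (Slot.lastOrOrigin H) (Slot.ref (Slot.lastOrOrigin H)) = lastState x := by
  cases t with
  | zero => rfl
  | succ t =>
    have h := (hH (Fin.last t)).2
    simp only [extendPath, Fin.val_castLE, Fin.val_last, Nat.lt_succ_self, dif_pos] at h
    exact h

theorem sum_weight_origin (H : Fin 0 → Slot D N) (c : Fin (N + 1) → ENNReal) :
    ∑ k, ENNReal.ofReal (Slot.weight (Slot.lastOrOrigin H) k) * c k = c 0 := by
  simp [Slot.lastOrOrigin, Slot.origin, Slot.weight, Pi.single_apply, apply_ite ENNReal.ofReal]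

/-- The records along a random reference path from the model are those of the particle system,
with the last reference index drawn according to the last weights. -/
theorem lintegral_forwardLaw (hδ : ∀ t, 0 < δ t) (t : ℕ) (ht : t ≤ T)
    {g : (Fin t → Slot D N) → Fin (N + 1) → ENNReal} (hg : ∀ k, Measurable fun H => g H k) :
    ∫⁻ x : Fin t → State D, partialDensity F t ht x *
        ∫⁻ H, g (fun i => Slot.erase (H i)) (Slot.ref (Slot.lastOrOrigin H))
          ∂forwardLaw F κ δ N (extendPath x) t ht =
      systemIntegral F κ δ t ht fun H =>
        ∑ k, ENNReal.ofReal (Slot.weight (Slot.lastOrOrigin H) k) * g H k := by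
  induction t with
  | zero =>
    simp only [lintegral_forwardLaw_zero, systemIntegral]
    rw [lintegral_unique, sum_weight_origin, volume_pi, Measure.pi_empty_univ, mul_one]
    simp only [partialDensity, Finset.univ_eq_empty, Finset.prod_empty, one_mul]
    exact congrArg (fun H => g H 0) (Subsingleton.elim _ _)
  | succ t ih =>
    have ht' : t ≤ T := Nat.le_of_succ_le ht
    set τ : Fin T := ⟨t, ht⟩ with hτ
    have hgp : Measurable fun p : (Fin (t + 1) → Slot D N) × Fin (N + 1) => g p.1 p.2 :=
      measurable_from_prod_countable_left hg
    have herase : ∀ m, Measurable fun (H : Fin m → Slot D N) i => Slot.erase (H i) := fun m =>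
      measurable_pi_iff.2 fun i => Slot.measurable_erase (measurable_pi_apply i)
    -- R is the contribution of step t + 1 when the reference moves from x to y; G below integrates
    -- out y after replacing x by the particle with index k, and serves as the test function for the
    -- induction hypothesis.
    set R : (Fin t → Slot D N) → Fin (N + 1) → State D → State D → ENNReal := fun H k x y =>
      ENNReal.ofReal (F.Q τ x y) * stepIntegral F κ δ τ (Slot.lastOrOrigin H) k x y
        fun s => g (Fin.snoc (α := fun _ => Slot D N) H (Slot.erase s)) (Slot.ref s) with hR
    have hRm : ∀ {H : (Fin t → Slot D N) × State D → Fin t → Slot D N}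
        {k : (Fin t → Slot D N) × State D → Fin (N + 1)}
        {x : (Fin t → Slot D N) × State D → State D}, Measurable H → Measurable k → Measurable x →
        Measurable fun a => R (H a) (k a) (x a) a.2 := by
      intro H k x hH hk hx
      refine Measurable.mul (by fun_prop)
        (measurable_stepIntegral F κ δ τ (by fun_prop) hk hx measurable_snd ?_)
      exact hgp.comp (Measurable.prodMk (measurable_snoc (hH.comp measurable_fst)
        (Slot.measurable_erase measurable_snd)) (Slot.measurable_ref measurable_snd))
    set G : (Fin t → Slot D N) → Fin (N + 1) → ENNReal := fun H k =>
      ∫⁻ y, R H k (Slot.particle (Slot.lastOrOrigin H) k) y with hG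
    have hGm : ∀ k, Measurable fun H => G H k := by
      intro k
      refine Measurable.lintegral_prod_right ?_
      exact hRm measurable_fst measurable_const
        (Slot.measurable_particle (Slot.measurable_lastOrOrigin measurable_fst) k)
    have hgm : Measurable fun H : Fin (t + 1) → Slot D N =>
        g (fun i => Slot.erase (H i)) (Slot.ref (Slot.lastOrOrigin H)) :=
      hgp.comp ((herase _).prodMk
        (Slot.measurable_ref (Slot.measurable_lastOrOrigin measurable_id)))
    have hm : Measurable fun x : Fin (t + 1) → State D => partialDensity F (t + 1) ht x *
        ∫⁻ H, g (fun i => Slot.erase (H i)) (Slot.ref (Slot.lastOrOrigin H))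
          ∂forwardLaw F κ δ N (extendPath x) (t + 1) ht :=
      (measurable_partialDensity F _ _).mul ((Measure.measurable_lintegral hgm).comp
        ((measurable_forwardLaw F κ δ hδ (t + 1) ht).1.comp measurable_extendPath))
    rw [lintegral_snoc hm]
    have hstep : ∀ (x : Fin t → State D) (y : State D),
        partialDensity F (t + 1) ht (Fin.snoc (α := fun _ => State D) x y) *
          ∫⁻ H, g (fun i => Slot.erase (H i)) (Slot.ref (Slot.lastOrOrigin H))
            ∂forwardLaw F κ δ N (extendPath (Fin.snoc (α := fun _ => State D) x y)) (t + 1) ht =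
        partialDensity F t ht' x * ∫⁻ H, R (fun i => Slot.erase (H i))
          (Slot.ref (Slot.lastOrOrigin H)) (lastState x) y
            ∂forwardLaw F κ δ N (extendPath x) t ht' := by
      intro x y
      rw [lintegral_forwardLaw_succ F κ δ hδ _ t ht hgm, partialDensity_snoc, mul_assoc,
        pred_extendPath, extendPath_snoc_last,
        forwardLaw_congr F κ δ t ht' (extendPath_snoc_lt x y), ← lintegral_const_mul]
      · simp_rw [erase_snoc, hR, lastOrOrigin_erase]
        congr 1
        refine lintegral_congr fun H => ?_
        simp only [lastOrOrigin_snoc]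
        rfl
      · refine measurable_stepIntegral F κ δ τ (by fun_prop) (by fun_prop) measurable_const
          measurable_const ?_
        exact hgm.comp (measurable_snoc measurable_fst measurable_snd)
    have hswap : ∀ x : Fin t → State D, ∫⁻ y, partialDensity F t ht' x *
        ∫⁻ H, R (fun i => Slot.erase (H i)) (Slot.ref (Slot.lastOrOrigin H)) (lastState x) y
            ∂forwardLaw F κ δ N (extendPath x) t ht' =
        partialDensity F t ht' x * ∫⁻ H, G (fun i => Slot.erase (H i))
          (Slot.ref (Slot.lastOrOrigin H)) ∂forwardLaw F κ δ N (extendPath x) t ht' := by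
      intro x
      -- Tonelli's theorem for y and the records requires the law of the records to be s-finite.
      have := (measurable_forwardLaw (N := N) F κ δ hδ t ht').2 (extendPath x)
      have hRx : Measurable fun p : (Fin t → Slot D N) × State D =>
          R (fun i => Slot.erase (p.1 i)) (Slot.ref (Slot.lastOrOrigin p.1)) (lastState x) p.2 :=
        hRm ((herase t).comp measurable_fst)
          (Slot.measurable_ref (Slot.measurable_lastOrOrigin measurable_fst)) measurable_const
      rw [lintegral_const_mul _ (Measurable.lintegral_prod_left hRx),
        ← lintegral_lintegral_swap hRx.aemeasurable]
      congr 1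
      refine lintegral_congr_ae ?_
      -- Almost surely the last reference state is the particle with the reference index, so the
      -- path enters only through the records.
      filter_upwards [forwardLaw_ae F κ δ hδ (extendPath x) t ht'] with H hH
      simp only [hG, ← hH.particle_lastOrOrigin, lastOrOrigin_erase]
      rfl
    simp_rw [hstep, hswap]
    rw [ih ht' hGm]
    refine systemIntegral_congr F κ δ hδ t ht' fun H hH => ?_
    have h := sum_lintegral_stepIntegral F κ δ hδ τ hH.1
      (h := fun k s => g (Fin.snoc (α := fun _ => Slot D N) H s) k)
      fun k => (hg k).comp (measurable_snoc measurable_const measurable_id)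
    refine h.trans ?_
    simp only [lastOrOrigin_snoc, hτ]

/-- Backward sampling: the expected value of `f` at the selected path, given the records and the
last selected index `j`. -/
def backwardIntegral : (t : ℕ) → t ≤ T → (Fin t → Slot D N) → Fin (N + 1) →
    ((Fin t → State D) → ENNReal) → ENNReal
  | 0, _, _, _, f => f fun i => i.elim0
  | t + 1, ht, H, j, f => ∑ i, ENNReal.ofReal (backwardProb F κ δ ⟨t, ht⟩
      (Slot.lastOrOrigin (Fin.init (α := fun _ => Slot D N) H)) (H (Fin.last t)) j i) *
        backwardIntegral t (Nat.le_of_succ_le ht) (Fin.init (α := fun _ => Slot D N) H) i fun x =>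
          f (Fin.snoc (α := fun _ => State D) x (Slot.particle (H (Fin.last t)) j))

theorem measurable_init {α β : Type*} [MeasurableSpace α] [MeasurableSpace β] {t : ℕ}
    {H : α → Fin (t + 1) → β} (hH : Measurable H) :
    Measurable fun a => (Fin.init (α := fun _ => β) (H a) : Fin t → β) :=
  measurable_pi_iff.2 fun i => (measurable_pi_apply i.castSucc).comp hH

theorem measurable_backwardIntegral (t : ℕ) (ht : t ≤ T) {α : Type*} [MeasurableSpace α]
    {H : α → Fin t → Slot D N} {f : α → (Fin t → State D) → ENNReal} (hH : Measurable H)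
    (hf : Measurable (Function.uncurry f)) (j : Fin (N + 1)) :
    Measurable fun a => backwardIntegral F κ δ t ht (H a) j (f a) := by
  induction t generalizing j with
  | zero =>
    have h := hf.comp (measurable_prodMk_right (y := (fun i => i.elim0 : Fin 0 → State D)))
    exact h
  | succ t ih =>
    have hHi := measurable_init hH
    have hl : Measurable fun a => H a (Fin.last t) := (measurable_pi_apply _).comp hH
    refine Finset.measurable_sum _ fun i _ => Measurable.mul (by fun_prop) (ih _ hHi ?_ i)
    exact hf.comp (measurable_fst.prodMk (measurable_snoc measurable_snd
      (Slot.measurable_particle (hl.comp measurable_fst) j)))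

theorem backwardIntegral_const_mul (t : ℕ) (ht : t ≤ T) (H : Fin t → Slot D N) (j : Fin (N + 1))
    (c : ENNReal) (f : (Fin t → State D) → ENNReal) :
    backwardIntegral F κ δ t ht H j (fun x => c * f x) = c * backwardIntegral F κ δ t ht H j f := by
  induction t generalizing j with
  | zero => rfl
  | succ t ih =>
    simp only [backwardIntegral, ih, Finset.mul_sum]
    exact Finset.sum_congr rfl fun i _ => mul_left_comm _ _ _

/-- The last state of the selected path is the particle with the last selected index. -/
theorem backwardIntegral_lastState_mul (t : ℕ) (ht : t ≤ T) (H : Fin t → Slot D N)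
    (j : Fin (N + 1)) (c : State D → ENNReal) (f : (Fin t → State D) → ENNReal) :
    backwardIntegral F κ δ t ht H j (fun x => c (lastState x) * f x) =
      c (Slot.particle (Slot.lastOrOrigin H) j) * backwardIntegral F κ δ t ht H j f := by
  cases t with
  | zero => rfl
  | succ t =>
    simp only [backwardIntegral, lastState, Fin.snoc_last, backwardIntegral_const_mul,
      Finset.mul_sum, Slot.lastOrOrigin]
    exact Finset.sum_congr rfl fun i _ => mul_left_comm _ _ _

/-- For fixed records backward sampling is a finite weighted sum, so it commutes with integration
over a parameter. -/
theorem lintegral_backwardIntegral (t : ℕ) (ht : t ≤ T) {α : Type*} [MeasurableSpace α]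
    (μ : Measure α) (H : Fin t → Slot D N) {f : α → (Fin t → State D) → ENNReal}
    (hf : Measurable (Function.uncurry f)) (j : Fin (N + 1)) :
    ∫⁻ a, backwardIntegral F κ δ t ht H j (f a) ∂μ =
      backwardIntegral F κ δ t ht H j fun x => ∫⁻ a, f a x ∂μ := by
  induction t generalizing j with
  | zero => rfl
  | succ t ih =>
    have hfs : Measurable (Function.uncurry fun a (x : Fin t → State D) =>
        f a (Fin.snoc (α := fun _ => State D) x (Slot.particle (H (Fin.last t)) j))) :=
      hf.comp (measurable_fst.prodMk (measurable_snoc measurable_snd measurable_const))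
    simp only [backwardIntegral]
    have hm := fun i => measurable_backwardIntegral F κ δ t (Nat.le_of_succ_le ht)
      (H := fun _ : α => Fin.init (α := fun _ => Slot D N) H) measurable_const hfs i
    rw [lintegral_finsetSum _ fun i _ => (hm i).const_mul _]
    refine Finset.sum_congr rfl fun i _ => ?_
    rw [lintegral_const_mul _ (hm i), ih _ _ hfs]

/-- In the particle system, a path selected by backward sampling is a path from the model. -/
theorem systemIntegral_backwardIntegral (hδ : ∀ t, 0 < δ t) (t : ℕ) (ht : t ≤ T)
    {f : (Fin t → State D) → ENNReal} (hf : Measurable f) :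
    (systemIntegral F κ δ t ht fun H : Fin t → Slot D N =>
        ∑ j, ENNReal.ofReal (Slot.weight (Slot.lastOrOrigin H) j) *
          backwardIntegral F κ δ t ht H j f) =
      ∫⁻ x, partialDensity F t ht x * f x := by
  induction t with
  | zero =>
    rw [lintegral_unique, volume_pi, Measure.pi_empty_univ, mul_one, systemIntegral,
      sum_weight_origin]
    simp only [partialDensity, Finset.univ_eq_empty, Finset.prod_empty, one_mul]
    exact congrArg f (Subsingleton.elim _ _)
  | succ t ih =>
    have ht' : t ≤ T := Nat.le_of_succ_le ht
    set τ : Fin T := ⟨t, ht⟩ with hτ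
    have hfu : Measurable (Function.uncurry fun (y : State D) (x : Fin t → State D) =>
        f (Fin.snoc (α := fun _ => State D) x y)) :=
      hf.comp (measurable_snoc measurable_snd measurable_fst)
    have hQf : Measurable (Function.uncurry fun (y : State D) (x : Fin t → State D) =>
        ENNReal.ofReal (F.Q τ (lastState x) y) * f (Fin.snoc (α := fun _ => State D) x y)) :=
      Measurable.mul (f := fun p : State D × (Fin t → State D) =>
        ENNReal.ofReal (F.Q τ (lastState p.2) p.1)) (by fun_prop) hfu
    have hf' : Measurable fun x : Fin t → State D => ∫⁻ y,
        ENNReal.ofReal (F.Q τ (lastState x) y) * f (Fin.snoc (α := fun _ => State D) x y) :=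
      Measurable.lintegral_prod_left hQf
    -- The last step of system and backward sampling collapses to a model transition, which is
    -- absorbed into the test function on paths of length t.
    have hleft : systemIntegral F κ δ (t + 1) ht (fun H : Fin (t + 1) → Slot D N =>
        ∑ j, ENNReal.ofReal (Slot.weight (Slot.lastOrOrigin H) j) *
          backwardIntegral F κ δ (t + 1) ht H j f) =
        systemIntegral F κ δ t ht' fun H : Fin t → Slot D N =>
          ∑ i, ENNReal.ofReal (Slot.weight (Slot.lastOrOrigin H) i) *
            backwardIntegral F κ δ t ht' H i fun x => ∫⁻ y,
              ENNReal.ofReal (F.Q τ (lastState x) y) *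
                f (Fin.snoc (α := fun _ => State D) x y) := by
      rw [systemIntegral]
      refine systemIntegral_congr F κ δ hδ t ht' fun H hH => ?_
      have h := systemStep_backward F κ δ hδ τ hH
        (b := fun i y => backwardIntegral F κ δ t ht' H i fun x =>
          f (Fin.snoc (α := fun _ => State D) x y))
        fun i => measurable_backwardIntegral F κ δ t ht' measurable_const hfu i
      simp only [lastOrOrigin_snoc, backwardIntegral, Fin.snoc_last, Fin.init_snoc]
      refine h.trans (Finset.sum_congr rfl fun i _ => ?_)
      rw [← lintegral_backwardIntegral F κ δ t ht' _ H hQf i]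
      congr 1
      refine lintegral_congr fun y => ?_
      exact (backwardIntegral_lastState_mul F κ δ t ht' H i
        (fun x => ENNReal.ofReal (F.Q τ x y)) _).symm
    have hm : Measurable fun x => partialDensity F (t + 1) ht x * f x :=
      (measurable_partialDensity F _ _).mul hf
    rw [hleft, ih ht' hf', lintegral_snoc hm]
    refine lintegral_congr fun x => ?_
    have hx : Measurable fun y => ENNReal.ofReal (F.Q τ (lastState x) y) *
        f (Fin.snoc (α := fun _ => State D) x y) :=
      Measurable.mul (by fun_prop) (hf.comp (measurable_snoc measurable_const measurable_id))
    rw [← lintegral_const_mul _ hx]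
    refine lintegral_congr fun y => ?_
    rw [partialDensity_snoc, mul_assoc]

end Invariance

/-! ### The forced move of the last index -/

section ForcedMove

variable {N : ℕ} {W : Fin (N + 1) → ℝ}

/-- With at least two particles some other weight is positive; this makes the divisions by 1 - W^k
legitimate. -/
theorem weight_lt_one (hN : 1 ≤ N) (hW : ∀ n, 0 < W n) (hs : ∑ n, W n = 1) (k : Fin (N + 1)) :
    W k < 1 := by
  have : Nontrivial (Fin (N + 1)) := Fin.nontrivial_iff_two_le.2 (by omega)
  obtain ⟨i, hi⟩ := exists_ne k
  rw [← hs, ← Finset.add_sum_erase _ _ (Finset.mem_univ k)]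
  exact lt_add_of_pos_right _ (Finset.sum_pos (fun n _ => hW n)
    ⟨i, Finset.mem_erase.2 ⟨hi, Finset.mem_univ i⟩⟩)

theorem forcedMoveProb_nonneg (hN : 1 ≤ N) (hW : ∀ n, 0 < W n) (hs : ∑ n, W n = 1)
    (k l : Fin (N + 1)) : 0 ≤ forcedMoveProb W k l := by
  have h1 := fun n => sub_pos.2 (weight_lt_one hN hW hs n)
  refine Finset.sum_nonneg fun i _ => mul_nonneg (div_nonneg (hW i).le (h1 k).le)
    (add_nonneg ?_ ?_)
  · split_ifs
    · exact le_min zero_le_one (div_nonneg (h1 k).le (h1 i).le)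
    · exact le_rfl
  · split_ifs
    · exact sub_nonneg.2 (min_le_left _ _)
    · exact le_rfl

theorem sum_forcedMoveProb (hN : 1 ≤ N) (hW : ∀ n, 0 < W n) (hs : ∑ n, W n = 1)
    (k : Fin (N + 1)) : ∑ l, forcedMoveProb W k l = 1 := by
  unfold forcedMoveProb
  rw [Finset.sum_comm]
  simp_rw [← Finset.mul_sum, Finset.sum_add_distrib, Finset.sum_ite_eq' Finset.univ,
    Finset.mem_univ, if_true, add_sub_cancel, mul_one, ← Finset.sum_div]
  have h1 := sub_pos.2 (weight_lt_one hN hW hs k)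
  have h2 : ∑ i ∈ Finset.univ.erase k, W i = 1 - W k := by
    rw [← hs, ← Finset.add_sum_erase _ _ (Finset.mem_univ k), add_sub_cancel_left]
  rw [h2, div_self h1.ne']

/-- The forced move is reversible with respect to the weights. -/
theorem forcedMoveProb_balance (hN : 1 ≤ N) (hW : ∀ n, 0 < W n) (hs : ∑ n, W n = 1)
    (k l : Fin (N + 1)) : W k * forcedMoveProb W k l = W l * forcedMoveProb W l k := by
  rcases eq_or_ne k l with rfl | hkl
  · rfl
  have h1 := fun n => sub_pos.2 (weight_lt_one hN hW hs n)
  have hf : ∀ k l, l ≠ k →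
      forcedMoveProb W k l = W l / (1 - W k) * min 1 ((1 - W k) / (1 - W l)) := by
    intro k l hlk
    unfold forcedMoveProb
    rw [Finset.sum_eq_single_of_mem l (Finset.mem_erase.2 ⟨hlk, Finset.mem_univ l⟩)]
    · simp [hlk]
    · intro i _ hil
      simp [hlk, hil.symm]
  -- Absorbing 1/(1 - W^k) into the minimum leaves W^l times an expression symmetric in k and l,
  -- from which detailed balance is immediate.
  have hm : ∀ k l, W l / (1 - W k) * min 1 ((1 - W k) / (1 - W l)) =
      W l * min (1 - W k)⁻¹ (1 - W l)⁻¹ := by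
    intro k l
    have hk := h1 k
    rw [div_eq_mul_inv, mul_assoc, mul_min_of_nonneg _ _ (inv_nonneg.2 hk.le), mul_one,
      div_eq_mul_inv, inv_mul_cancel_left₀ hk.ne']
  rw [hf k l hkl.symm, hf l k hkl, hm, hm, min_comm]
  ring

theorem sum_weight_mul_forcedMoveProb (hN : 1 ≤ N) (hW : ∀ n, 0 < W n) (hs : ∑ n, W n = 1)
    (l : Fin (N + 1)) :
    ∑ k, ENNReal.ofReal (W k) * ENNReal.ofReal (forcedMoveProb W k l) = ENNReal.ofReal (W l) := by
  simp_rw [← fun k => ENNReal.ofReal_mul (q := forcedMoveProb W k l) (hW k).le,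
    forcedMoveProb_balance hN hW hs _ l]
  rw [← ENNReal.ofReal_sum_of_nonneg fun k _ =>
    mul_nonneg (hW l).le (forcedMoveProb_nonneg hN hW hs l k), ← Finset.mul_sum,
    sum_forcedMoveProb hN hW hs, mul_one]

theorem measurable_forcedMoveProb {α : Type*} [MeasurableSpace α] {V : α → Fin (N + 1) → ℝ}
    (hV : ∀ n, Measurable fun a => V a n) (k l : Fin (N + 1)) :
    Measurable fun a => forcedMoveProb (V a) k l := by
  unfold forcedMoveProb
  have hr : ∀ i, Measurable fun a => min 1 ((1 - V a k) / (1 - V a i)) := fun i =>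
    measurable_const.min (((hV k).const_sub 1).div ((hV i).const_sub 1))
  refine Finset.measurable_sum _ fun i _ => ((hV i).div ((hV k).const_sub 1)).mul (.add ?_ ?_)
  · split_ifs
    exacts [hr i, measurable_const]
  · split_ifs
    exacts [(hr i).const_sub 1, measurable_const]

end ForcedMove

theorem sum_snoc {β R : Type*} [Fintype β] [AddCommMonoid R] {t : ℕ}
    (φ : (Fin (t + 1) → β) → R) :
    ∑ l, φ l = ∑ j, ∑ l : Fin t → β, φ (Fin.snoc (α := fun _ => β) l j) := by
  rw [← Fintype.sum_prod_type' (fun j (l : Fin t → β) => φ (Fin.snoc (α := fun _ => β) l j))]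
  exact (Fintype.sum_equiv (Fin.snocEquiv fun _ => β) _ _ fun p => rfl).symm

/-! ### Selection of the new path, and invariance of the full iteration -/

section Selection

variable {D T N : ℕ} (F : Model D T) (κ : ℝ) (δ : Fin T → ℝ)

/-- The probability of the indices `l` of the first `t` records under backward sampling, given the
index `j` in the record after them. -/
def backwardPathProb (t : ℕ) (ht : t + 1 ≤ T) (H : Fin (t + 1) → Slot D N) (j : Fin (N + 1))
    (l : Fin t → Fin (N + 1)) : ℝ :=
  ∏ i : Fin t, backwardProb F κ δ ⟨i.val + 1, by omega⟩ (H i.castSucc) (H i.succ)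
    (Fin.snoc (α := fun _ => Fin (N + 1)) l j i.succ) (l i)

theorem backwardPathProb_snoc (t : ℕ) (ht : t + 2 ≤ T) (H : Fin (t + 2) → Slot D N)
    (j i : Fin (N + 1)) (l : Fin t → Fin (N + 1)) :
    backwardPathProb F κ δ (t + 1) ht H j (Fin.snoc (α := fun _ => Fin (N + 1)) l i) =
      backwardPathProb F κ δ t (Nat.le_of_succ_le ht)
          (Fin.init (α := fun _ => Slot D N) H) i l *
        backwardProb F κ δ ⟨t + 1, ht⟩ (H (Fin.last t).castSucc) (H (Fin.last (t + 1))) j i := by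
  unfold backwardPathProb
  rw [Fin.prod_univ_castSucc]
  congr 1
  · refine Finset.prod_congr rfl fun n _ => ?_
    rw [Fin.succ_castSucc, Fin.snoc_castSucc, Fin.snoc_castSucc]
    rfl
  · rw [Fin.succ_last, Fin.snoc_last, Fin.snoc_last]
    rfl

/-- Backward sampling as a sum over all index sequences. -/
theorem backwardIntegral_eq_sum (hδ : ∀ t, 0 < δ t) (t : ℕ) (ht : t + 1 ≤ T)
    {H : Fin (t + 1) → Slot D N} (hH : ∀ i, Slot.IsNormalized (H i)) (j : Fin (N + 1))
    (f : (Fin (t + 1) → State D) → ENNReal) :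
    backwardIntegral F κ δ (t + 1) ht H j f =
      ∑ l : Fin t → Fin (N + 1), ENNReal.ofReal (backwardPathProb F κ δ t ht H j l) *
        f fun i => Slot.particle (H i) (Fin.snoc (α := fun _ => Fin (N + 1)) l j i) := by
  have hpath : ∀ (m : ℕ) (H : Fin (m + 1) → Slot D N) (l : Fin m → Fin (N + 1)) (j : Fin (N + 1)),
      (Fin.snoc (α := fun _ => State D) (fun i => Slot.particle (H i.castSucc) (l i))
        (Slot.particle (H (Fin.last m)) j) : Fin (m + 1) → State D) =
      fun i => Slot.particle (H i) (Fin.snoc (α := fun _ => Fin (N + 1)) l j i) := by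
    intro m H l j
    funext i
    induction i using Fin.lastCases <;> simp
  induction t generalizing j with
  | zero =>
    -- `backwardIntegral` makes one extra backward step, from the first record into `origin`. Its
    -- outcome affects nothing and its probabilities sum to one.
    have hs := sum_backwardProb F κ δ hδ ⟨0, ht⟩ (Slot.weight_lastOrOrigin
      (H := Fin.init (α := fun _ => Slot D N) H) fun i => i.elim0) (H (Fin.last 0)) j
    rw [Fintype.sum_unique]
    simp only [backwardIntegral]
    rw [← Finset.sum_mul, hs]
    simp only [backwardPathProb, Finset.univ_eq_empty, Finset.prod_empty, ENNReal.ofReal_one]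
    congr 1
    refine congrArg f (Eq.trans ?_ (hpath 0 H default j))
    exact congrArg (fun x => Fin.snoc (α := fun _ => State D) x _) (Subsingleton.elim _ _)
  | succ t ih =>
    rw [backwardIntegral, sum_snoc]
    refine Finset.sum_congr rfl fun i _ => ?_
    rw [ih _ (H := Fin.init (α := fun _ => Slot D N) H) (fun i => hH i.castSucc), Finset.mul_sum]
    refine Finset.sum_congr rfl fun l _ => ?_
    have hb : 0 ≤ backwardProb F κ δ ⟨t + 1, ht⟩ (H (Fin.last t).castSucc)
        (H (Fin.last (t + 1))) j i := backwardProb_nonneg F κ δ hδ _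
      ⟨fun n => ((hH _).1 n).le, (hH _).2⟩ _ _ _
    rw [backwardPathProb_snoc, mul_comm (backwardPathProb _ _ _ _ _ _ _ _), ENNReal.ofReal_mul hb,
      mul_assoc, ← hpath (t + 1) H]
    simp only [← hpath t]
    congr 4

theorem selectionProb_snoc {t : ℕ} (F : Model D (t + 1)) (δ : Fin (t + 1) → ℝ)
    (H : Fin (t + 1) → Slot D N) (j : Fin (N + 1)) (l : Fin t → Fin (N + 1)) :
    selectionProb F κ δ H (Fin.snoc (α := fun _ => Fin (N + 1)) l j) =
      forcedMoveProb (Slot.weight (H (Fin.last t))) (Slot.ref (H (Fin.last t))) j *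
        backwardPathProb F κ δ t le_rfl H j l := by
  unfold selectionProb backwardPathProb
  rw [Fin.prod_univ_castSucc, mul_comm]
  congr 1
  · rw [dif_neg (by simp), Fin.snoc_last]
  · refine Finset.prod_congr rfl fun i _ => ?_
    rw [dif_pos (by simp), Fin.snoc_castSucc]
    rfl

/-- The selected path, as the forced move followed by backward sampling. -/
theorem sum_selectionProb {t : ℕ} (F : Model D (t + 1)) (δ : Fin (t + 1) → ℝ)
    (hδ : ∀ t, 0 < δ t) (hN : 1 ≤ N) {H : Fin (t + 1) → Slot D N}
    (hH : ∀ i, Slot.IsNormalized (H i)) (f : Path D (t + 1) → ENNReal) :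
    ∑ l, ENNReal.ofReal (selectionProb F κ δ H l) * f (fun i => Slot.particle (H i) (l i)) =
      ∑ j, ENNReal.ofReal (forcedMoveProb (Slot.weight (H (Fin.last t)))
          (Slot.ref (H (Fin.last t))) j) *
        backwardIntegral F κ δ (t + 1) le_rfl H j f := by
  rw [sum_snoc]
  refine Finset.sum_congr rfl fun j _ => ?_
  rw [backwardIntegral_eq_sum F κ δ hδ t le_rfl hH, Finset.mul_sum]
  refine Finset.sum_congr rfl fun l _ => ?_
  rw [selectionProb_snoc, ENNReal.ofReal_mul (forcedMoveProb_nonneg hN (hH _).1 (hH _).2 _ _),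
    mul_assoc]

theorem backwardIntegral_one (hδ : ∀ t, 0 < δ t) (t : ℕ) (ht : t ≤ T) {H : Fin t → Slot D N}
    (hH : ∀ i, Slot.IsNormalized (H i)) (j : Fin (N + 1)) :
    backwardIntegral F κ δ t ht H j (fun _ => 1) = 1 := by
  induction t generalizing j with
  | zero => rfl
  | succ t ih =>
    have hi : ∀ i, Slot.IsNormalized (Fin.init (α := fun _ => Slot D N) H i) :=
      fun i => hH i.castSucc
    simp only [backwardIntegral, ih _ hi, mul_one]
    exact sum_backwardProb F κ δ hδ _ (Slot.weight_lastOrOrigin hi) _ _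

/-- Backward sampling uses the auxiliary variables, particles and weights only. Hence just the last
reference index, through the forced move, influences the selection, and the earlier ones may be
summed out. -/
theorem backwardIntegral_erase (t : ℕ) (ht : t ≤ T) (H : Fin t → Slot D N) (j : Fin (N + 1))
    (f : (Fin t → State D) → ENNReal) :
    backwardIntegral F κ δ t ht (fun i => Slot.erase (H i)) j f =
      backwardIntegral F κ δ t ht H j f := by
  induction t generalizing j with
  | zero => rfl
  | succ t ih =>
    have hi : (Fin.init (α := fun _ => Slot D N) fun i => Slot.erase (H i)) =
        fun i => Slot.erase (Fin.init (α := fun _ => Slot D N) H i) := rfl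
    simp only [backwardIntegral, hi, ih, lastOrOrigin_erase]
    rfl

/-- The law of the selected path given all the records. -/
def selectionLaw (H : Fin T → Slot D N) : Measure (Path D T) :=
  ∑ l : Fin T → Fin (N + 1), ENNReal.ofReal (selectionProb F κ δ H l) •
    Measure.dirac fun t => Slot.particle (H t) (l t)

theorem measurable_selectionProb (l : Fin T → Fin (N + 1)) :
    Measurable fun H : Fin T → Slot D N => selectionProb F κ δ H l := by
  unfold selectionProb
  refine Finset.measurable_prod _ fun t _ => ?_
  split_ifs with h
  · exact measurable_backwardProb F κ δ ⟨t.val + 1, h⟩ (s := fun H : Fin T → Slot D N => H t)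
      (measurable_pi_apply t) (measurable_pi_apply _) _ _
  · have h1 : Measurable fun p : (Fin T → Slot D N) × Fin (N + 1) =>
        forcedMoveProb (Slot.weight (p.1 t)) p.2 (l t) :=
      measurable_from_prod_countable_left fun k => measurable_forcedMoveProb
        (fun n => Slot.measurable_weight (measurable_pi_apply t) n) k (l t)
    exact h1.comp (measurable_id.prodMk (Slot.measurable_ref (measurable_pi_apply t)))

theorem lintegral_selectionLaw (H : Fin T → Slot D N) {f : Path D T → ENNReal}
    (hf : Measurable f) : ∫⁻ x, f x ∂selectionLaw F κ δ H =
      ∑ l, ENNReal.ofReal (selectionProb F κ δ H l) * f fun t => Slot.particle (H t) (l t) := by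
  unfold selectionLaw
  rw [lintegral_finsetSum_measure]
  refine Finset.sum_congr rfl fun l _ => ?_
  rw [lintegral_smul_measure, lintegral_dirac' _ hf, smul_eq_mul]

theorem measurable_selectionLaw :
    Measurable (selectionLaw F κ δ : (Fin T → Slot D N) → Measure (Path D T)) := by
  refine Measure.measurable_of_measurable_coe _ fun A hA => ?_
  have hA1 : Measurable (A.indicator fun _ => (1 : ENNReal)) := measurable_const.indicator hA
  have h : ∀ H : Fin T → Slot D N, selectionLaw F κ δ H A =
      ∑ l, ENNReal.ofReal (selectionProb F κ δ H l) *
        A.indicator (fun _ => (1 : ENNReal)) fun t => Slot.particle (H t) (l t) := fun H => by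
    rw [← lintegral_selectionLaw F κ δ H hA1, lintegral_indicator hA, lintegral_one,
      Measure.restrict_apply MeasurableSet.univ, Set.univ_inter]
  simp_rw [h]
  refine Finset.measurable_sum _ fun l _ =>
    (measurable_selectionProb F κ δ l).ennreal_ofReal.mul (hA1.comp (measurable_pi_iff.2 fun t =>
      Slot.measurable_particle (measurable_pi_apply t) (l t)))

theorem iterationLaw_eq_bind (x : Path D T) : iterationLaw F κ δ N x =
    (forwardLaw F κ δ N x T le_rfl).bind (selectionLaw F κ δ) := rfl

theorem measurable_iterationLaw (hδ : ∀ t, 0 < δ t) : Measurable (iterationLaw F κ δ N) :=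
  (Measure.measurable_bind' (measurable_selectionLaw F κ δ)).comp
    (measurable_forwardLaw F κ δ hδ T le_rfl).1

theorem lintegral_iterationLaw (x : Path D T) {f : Path D T → ENNReal} (hf : Measurable f) :
    ∫⁻ y, f y ∂iterationLaw F κ δ N x =
      ∫⁻ H, ∑ l, ENNReal.ofReal (selectionProb F κ δ H l) *
        f (fun t => Slot.particle (H t) (l t)) ∂forwardLaw F κ δ N x T le_rfl := by
  rw [iterationLaw_eq_bind, Measure.lintegral_bind
    (measurable_selectionLaw F κ δ).aemeasurable hf.aemeasurable]
  exact lintegral_congr fun H => lintegral_selectionLaw F κ δ H hf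

theorem isProbabilityMeasure_iterationLaw {t : ℕ} (F : Model D (t + 1)) (δ : Fin (t + 1) → ℝ)
    (hδ : ∀ t, 0 < δ t) (hN : 1 ≤ N) (x : Path D (t + 1)) :
    IsProbabilityMeasure (iterationLaw F κ δ N x) := by
  constructor
  rw [← lintegral_one, lintegral_iterationLaw F κ δ x measurable_const]
  have := (measurable_forwardLaw (N := N) F κ δ hδ (t + 1) le_rfl).2 x
  refine (lintegral_congr_ae (g := fun _ => 1) ?_).trans (by simp)
  filter_upwards [forwardLaw_ae F κ δ hδ x (t + 1) le_rfl] with H hH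
  have hn := fun i => (hH i).1
  rw [sum_selectionProb κ F δ hδ hN hn fun _ => 1]
  simp only [backwardIntegral_one F κ δ hδ _ _ hn, mul_one]
  rw [← ENNReal.ofReal_sum_of_nonneg fun j _ =>
    forcedMoveProb_nonneg hN (hn (Fin.last t)).1 (hn (Fin.last t)).2 _ j,
    sum_forcedMoveProb hN (hn (Fin.last t)).1 (hn (Fin.last t)).2, ENNReal.ofReal_one]

/-- The iteration preserves the unnormalised joint smoothing distribution. -/
theorem lintegral_pathDensity_iterationLaw {t : ℕ} (F : Model D (t + 1)) (δ : Fin (t + 1) → ℝ)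
    (hδ : ∀ t, 0 < δ t) (hN : 1 ≤ N) {f : Path D (t + 1) → ENNReal} (hf : Measurable f) :
    ∫⁻ x, ENNReal.ofReal (F.pathDensity x) * ∫⁻ y, f y ∂iterationLaw F κ δ N x =
      ∫⁻ x, ENNReal.ofReal (F.pathDensity x) * f x := by
  -- The expected value of f after selection, with the last reference index k separated from the
  -- erased records as `lintegral_forwardLaw` requires.
  set g : (Fin (t + 1) → Slot D N) → Fin (N + 1) → ENNReal := fun H k =>
    ∑ j, ENNReal.ofReal (forcedMoveProb (Slot.weight (Slot.lastOrOrigin H)) k j) *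
      backwardIntegral F κ δ (t + 1) le_rfl H j f with hg
  have hgm : ∀ k, Measurable fun H => g H k := fun k =>
    Finset.measurable_sum _ fun j _ => (measurable_forcedMoveProb (fun n =>
      Slot.measurable_weight (Slot.measurable_lastOrOrigin measurable_id) n) k j).ennreal_ofReal.mul
      (measurable_backwardIntegral F κ δ _ _ (f := fun _ => f) measurable_id
        (hf.comp measurable_snd) j)
  have hfwd : ∀ x : Path D (t + 1), ∫⁻ y, f y ∂iterationLaw F κ δ N x =
      ∫⁻ H, g (fun i => Slot.erase (H i)) (Slot.ref (Slot.lastOrOrigin H))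
        ∂forwardLaw F κ δ N x (t + 1) le_rfl := by
    intro x
    rw [lintegral_iterationLaw F κ δ x hf]
    refine lintegral_congr_ae ?_
    filter_upwards [forwardLaw_ae F κ δ hδ x (t + 1) le_rfl] with H hH
    rw [sum_selectionProb κ F δ hδ hN (fun i => (hH i).1) f]
    simp only [hg, backwardIntegral_erase, lastOrOrigin_erase]
    rfl
  have h1 := lintegral_forwardLaw F κ δ hδ (t + 1) le_rfl hgm
  simp only [partialDensity_self, extendPath_self, ← hfwd] at h1
  have h2 := systemIntegral_backwardIntegral (N := N) F κ δ hδ (t + 1) le_rfl hf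
  simp only [partialDensity_self] at h2
  rw [h1, ← h2]
  -- Both sides are now integrals over the same particle system, with the last index drawn from the
  -- weights; they differ only by the forced move, which preserves the weights.
  refine systemIntegral_succ_congr F κ δ hδ t le_rfl fun H hH => ?_
  simp only [hg, Finset.mul_sum, ← mul_assoc]
  rw [Finset.sum_comm]
  refine Finset.sum_congr rfl fun j _ => ?_
  rw [← Finset.sum_mul]
  congr 1
  exact sum_weight_mul_forcedMoveProb hN hH.1 hH.2 j

theorem measurable_ofReal_pathDensity :
    Measurable fun x : Path D T => ENNReal.ofReal (F.pathDensity x) := by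
  simp only [← partialDensity_self]
  exact measurable_partialDensity F T le_rfl

/-- The joint smoothing distribution is invariant under the iteration. -/
theorem smoothing_bind_iterationLaw {t : ℕ} (F : Model D (t + 1)) (δ : Fin (t + 1) → ℝ)
    (hδ : ∀ t, 0 < δ t) (hN : 1 ≤ N) :
    F.smoothing.bind (iterationLaw F κ δ N) = F.smoothing := by
  have hm := measurable_iterationLaw (N := N) F κ δ hδ
  unfold Model.smoothing
  -- The normalising constant factors out, so it suffices to treat the unnormalised measure.
  rw [Measure.bind_smul]
  congr 1
  refine Measure.ext_of_lintegral _ fun f hf => ?_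
  have hfm : Measurable fun x => ∫⁻ y, f y ∂iterationLaw F κ δ N x :=
    (Measure.measurable_lintegral hf).comp hm
  rw [Measure.lintegral_bind hm.aemeasurable hf.aemeasurable,
    lintegral_withDensity_eq_lintegral_mul _ (measurable_ofReal_pathDensity F) hfm,
    lintegral_withDensity_eq_lintegral_mul _ (measurable_ofReal_pathDensity F) hf]
  exact lintegral_pathDensity_iterationLaw κ F δ hδ hN hf

end Selection

end ParticleAGrad

end

theorem mainTheorem8 {D T N : ℕ} (hT : 1 ≤ T) (hN : 1 ≤ N)
    (F : ParticleAGrad.Model D T)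
    (hF : Integrable F.pathDensity (volume : Measure (ParticleAGrad.Path D T)))
    (κ : ℝ) (hκ : κ = 0 ∨ κ = 1) (δ : Fin T → ℝ) (hδ : ∀ t, 0 < δ t) :
    -- the iteration is a Markov kernel that leaves the joint smoothing distribution invariant
    (∃ P : Kernel (ParticleAGrad.Path D T) (ParticleAGrad.Path D T),
      (∀ x, P x = ParticleAGrad.iterationLaw F κ δ N x) ∧
      IsMarkovKernel P ∧
      P.Invariant F.smoothing) ∧
    -- the proposal is `p(x_t | x_{t-1}, u_t)` in the model with transition density `M_t` and
    -- pseudo-observations `u_t` given `x_t` with density `N(u_t; x_t, (δ_t/2) I)`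
    (∀ t x u,
      F.propLaw δ t x u =
        volume.withDensity (fun y => ENNReal.ofReal (F.propDensity δ t x u y)) ∧
      (∀ y, F.propDensity δ t x u y =
        F.M t x y * ParticleAGrad.gaussDensity y (ParticleAGrad.Model.auxCov δ t) u /
          ∫ z, F.M t x z * ParticleAGrad.gaussDensity z (ParticleAGrad.Model.auxCov δ t) u) ∧
      F.propCov δ t x = (δ t / 2) • F.A δ t x) := by
  -- There is a last time step, at which the forced move takes place.
  obtain ⟨t, rfl⟩ : ∃ t, T = t + 1 := ⟨T - 1, by omega⟩
  refine ⟨⟨⟨ParticleAGrad.iterationLaw F κ δ N, ParticleAGrad.measurable_iterationLaw F κ δ hδ⟩,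
    fun _ => rfl, ⟨ParticleAGrad.isProbabilityMeasure_iterationLaw κ F δ hδ hN⟩,
    ParticleAGrad.smoothing_bind_iterationLaw κ F δ hδ hN⟩, fun t x u =>
    ⟨F.propLaw_eq_withDensity δ hδ t x u, F.propDensity_eq_posterior δ hδ t x u,
      F.propCov_eq δ hδ t x⟩⟩
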